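/- Theorem 1.1. Let $\mathbb S^3=\{(z_1,z_2)\in\mathbb C^2:|z_1|^2+|z_2|^2=1\}$, $z_j=x_j+iy_j$, with the round metric and its volume form, let $J$ be the complex structure (multiplication by $i$) of $\mathbb C^2$, and call a vector field on $\mathbb S^3$ Legendrian if it is tangent to the kernel of the standard contact form $-y_1dx_1+x_1dy_1-y_2dx_2+x_2dy_2$. Put $$v_1=-x_2\partial_{x_1}+y_2\partial_{y_1}+x_1\partial_{x_2}-y_1\partial_{y_2},\qquad v_2=-y_2\partial_{x_1}-x_2\partial_{y_1}+y_1\partial_{x_2}+x_1\partial_{y_2},$$ and for $(x,y,z,t)\in\mathbb R^{3+1}$, with $d=x^2+y^2+z^2-(t-i)^2$, $$\alpha=\frac{x^2+y^2+z^2-t^2-1+2iz}{d},\qquad \beta=\frac{2(x-iy)}{d},\qquad \lambda=\frac{8\,(1+x^2+y^2+(z-t)^2)}{|d|^4};$$ $(\alpha,\beta)$ takes its values in $\mathbb S^3$. A pair $(E_0,B_0)$ of vector fields on $\mathbb S^3$ is said to arise from a Hopf-type Bateman null solution if there is a function $h$, holomorphic on a neighbourhood of $\mathbb S^3$ in $\mathbb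 C^2$, such that * the real and imaginary parts $E$, $B$ of $F=h(\alpha,\beta)\,\nabla\alpha\times\nabla\beta$ are smooth on $\mathbb R^{3+1}$, satisfy Maxwell's equations $\partial_tE=\operatorname{curl}B$, $\partial_tB=-\operatorname{curl}E$, $\operatorname{div}E=\operatorname{div}B=0$, and are null, that is $E\cdot B=0$ and $|E|=|B|$ everywhere; * $E_0+iB_0=h\,(v_1+iv_2)$ on $\mathbb S^3$, i.e. $E_0=\operatorname{Re}(h)v_1-\operatorname{Im}(h)v_2$ and $B_0=\operatorname{Im}(h)v_1+\operatorname{Re}(h)v_2$; * for every $t$, the pushforwards of $E$ and $B$ by $(\alpha,\beta)|_t$ are $E_0$ and $B_0$ up to the factor $\lambda$: $D(\alpha,\beta)|_t\,E=\lambda\,E_0\circ(\alpha,\beta)|_t$ and $D(\alpha,\beta)|_t\,B=\lambda\,B_0\circ(\alpha,\beta)|_t$ on $\mathbb R^3$. Let $E_0$ be a real-analytic Legendrian vector field on $\mathbb S^3$ and $B_0=JE_0$. Then $(E_0,B_0)$ arises from a Hopf-type Bateman null solution if and only if $E_0$ and $B_0$ are both divergence-free on $\mathbb S^3$. Moreover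 there is a unique function $\Theta:\mathbb S^3\to\mathbb C$ with $E_0=\operatorname{Re}(\Theta)v_1-\operatorname{Im}(\Theta)v_2$; it is real-analytic, $B_0=\operatorname{Im}(\Theta)v_1+\operatorname{Re}(\Theta)v_2$, and the two equivalent conditions above are also equivalent to each of the following: $\Theta$ satisfies the tangential Cauchy–Riemann equations $-z_2\,\partial_{\bar z_1}\Theta+z_1\,\partial_{\bar z_2}\Theta=0$ on $\mathbb S^3$ (the operator is tangent to $\mathbb S^3$, so it may be computed with any smooth extension of $\Theta$); $\Theta$ extends to a holomorphic function on a neighbourhood of $\mathbb S^3$ in $\mathbb C^2$. -/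

import Mathlib

open scoped Manifold ContDiff Matrix ComplexConjugate

noncomputable section

namespace HopfBateman

/-! ### The unit sphere of `ℂ²` and vector fields on it -/

/-- `ℂ²` with its Hermitian norm; as a real Euclidean space it is `ℝ⁴`, with coordinates
`z₁ = z 0 = x₁ + i y₁` and `z₂ = z 1 = x₂ + i y₂`. -/
abbrev C2 : Type := EuclideanSpace ℂ (Fin 2)

/-- Physical space `ℝ³`. -/
abbrev R3 : Type := EuclideanSpace ℝ (Fin 3)

instance finrank_C2 : Fact (Module.finrank ℝ C2 = 3 + 1) :=
  ⟨by rw [finrank_real_of_complex, finrank_euclideanSpace_fin]⟩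

/-- The unit sphere `𝕊³ = {|z₁|² + |z₂|² = 1}`. -/
abbrev S3 : Type := Metric.sphere (0 : C2) 1

/-- A map on `𝕊³` is real-analytic (as a map from the real-analytic manifold `𝕊³`). A vector field
on `𝕊³` is represented by a map `X : S3 → C2` whose value at `p` is a vector of `ℝ⁴ = ℂ²` tangent
to the sphere at `p`. -/
def IsRealAnalytic {V : Type} [NormedAddCommGroup V] [NormedSpace ℝ V] (f : S3 → V) : Prop :=
  ContMDiff (𝓡 3) 𝓘(ℝ, V) ω f

/-- The standard contact form `-y₁ dx₁ + x₁ dy₁ - y₂ dx₂ + x₂ dy₂`, at `z`, on the vector `w`. -/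
def contactForm (z w : C2) : ℝ :=
  -(z 0).im * (w 0).re + (z 0).re * (w 0).im - (z 1).im * (w 1).re + (z 1).re * (w 1).im

/-- `X` is a vector field on `𝕊³` (i.e. tangent to `𝕊³`) and is Legendrian with respect to the
standard contact structure. -/
def IsLegendrian (X : S3 → C2) : Prop :=
  ∀ p : S3, inner ℝ (p : C2) (X p) = 0 ∧ contactForm p (X p) = 0

/-- The complex structure `J` of `ℂ²`, applied to a vector field: multiplication by `i`. -/
def J (X : S3 → C2) : S3 → C2 := fun p => Complex.I • X p

/-- The Hopf field `v₁ = -x₂ ∂x₁ + y₂ ∂y₁ + x₁ ∂x₂ - y₁ ∂y₂`. -/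
def v₁ (z : C2) : C2 := !₂[⟨-(z 1).re, (z 1).im⟩, ⟨(z 0).re, -(z 0).im⟩]

/-- The Hopf field `v₂ = -y₂ ∂x₁ - x₂ ∂y₁ + y₁ ∂x₂ + x₁ ∂y₂`. -/
def v₂ (z : C2) : C2 := !₂[⟨-(z 1).im, -(z 1).re⟩, ⟨(z 0).im, (z 0).re⟩]

/-- `X` is the real part `Re (f) v₁ - Im (f) v₂` of `f (v₁ + i v₂)` on `𝕊³`: `f` is the coefficient
function of `X`. -/
def IsRePart (f : S3 → ℂ) (X : S3 → C2) : Prop :=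
  ∀ p : S3, X p = (f p).re • v₁ p - (f p).im • v₂ p

/-- `X` is the imaginary part `Im (f) v₁ + Re (f) v₂` of `f (v₁ + i v₂)` on `𝕊³`. -/
def IsImPart (f : S3 → ℂ) (X : S3 → C2) : Prop :=
  ∀ p : S3, X p = (f p).im • v₁ p + (f p).re • v₂ p

/-- Normalisation `z ↦ z / |z|` of a nonzero vector. -/
def toSphere (z : C2) (hz : z ≠ 0) : S3 :=
  ⟨(‖z‖⁻¹ : ℝ) • z, by
    rw [mem_sphere_zero_iff_norm, norm_smul, norm_inv, norm_norm,
      inv_mul_cancel₀ (norm_ne_zero_iff.mpr hz)]⟩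

open Classical in
/-- The extension `z ↦ f (z / |z|)` of a function on `𝕊³` that is constant along rays (with
the irrelevant value `0` at the origin). -/
def radialExt {V : Type} [NormedAddCommGroup V] (f : S3 → V) (z : C2) : V :=
  if hz : z = 0 then 0 else f (toSphere z hz)

/-- Divergence on the round sphere `𝕊³`: `div X = ∑ ⟨∇_{eᵢ} X, eᵢ⟩` over an orthonormal basis `eᵢ` of
the tangent space at `p`, where `∇` is the tangential part of the flat derivative. The derivative
of the radially constant extension vanishes in the normal direction `p`, so that the sum is the
trace of its full derivative on `ℝ⁴`. -/
def divS3 (X : S3 → C2) (p : S3) : ℝ :=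
  LinearMap.trace ℝ C2 (fderiv ℝ (radialExt X) (p : C2) : C2 →ₗ[ℝ] C2)

/-! ### Tangential Cauchy-Riemann equations and holomorphic extension -/

/-- The operator `∂/∂z̄ⱼ = (∂/∂xⱼ + i ∂/∂yⱼ) / 2` on functions on `ℂ²`. -/
def dzbar (j : Fin 2) (g : C2 → ℂ) (z : C2) : ℂ :=
  (fderiv ℝ g z (EuclideanSpace.single j 1)
    + Complex.I * fderiv ℝ g z (EuclideanSpace.single j Complex.I)) / 2

/-- The tangential Cauchy-Riemann operator
`L̄ f = (-x₂ - i y₂) ∂f/∂z̄₁ + (x₁ + i y₁) ∂f/∂z̄₂` on functions on `𝕊³`. Being tangent to the sphere,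
it may be computed with any extension of `f`. -/
def Lbar (f : S3 → ℂ) (p : S3) : ℂ :=
  -((p : C2) 1) * dzbar 0 (radialExt f) p + (p : C2) 0 * dzbar 1 (radialExt f) p

/-- The tangential Cauchy-Riemann equations. -/
def IsCR (f : S3 → ℂ) : Prop := ∀ p : S3, Lbar f p = 0

/-- `h` is holomorphic on some neighbourhood of `𝕊³` in `ℂ²`. -/
def IsHolomorphicNearS3 (h : C2 → ℂ) : Prop :=
  ∃ U : Set C2, IsOpen U ∧ Metric.sphere (0 : C2) 1 ⊆ U ∧ DifferentiableOn ℂ h U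

/-- `f` extends to a holomorphic function on some neighbourhood of `𝕊³`. -/
def ExtendsHolomorphically (f : S3 → ℂ) : Prop :=
  ∃ h : C2 → ℂ, IsHolomorphicNearS3 h ∧ ∀ p : S3, h p = f p

/-! ### Maxwell's equations and null fields on `ℝ³` -/

/-- Partial derivative `∂ᵢ` on `ℝ³`. -/
def pd {V : Type} [NormedAddCommGroup V] [NormedSpace ℝ V] (i : Fin 3) (f : R3 → V) (x : R3) : V :=
  fderiv ℝ f x (EuclideanSpace.single i 1)

/-- Divergence on `ℝ³`. -/
def div3 (X : R3 → R3) (x : R3) : ℝ := ∑ i, pd i (fun y => X y i) x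

/-- Curl on `ℝ³`. -/
def curl3 (X : R3 → R3) (x : R3) : R3 :=
  !₂[pd 1 (fun y => X y 2) x - pd 2 (fun y => X y 1) x,
     pd 2 (fun y => X y 0) x - pd 0 (fun y => X y 2) x,
     pd 0 (fun y => X y 1) x - pd 1 (fun y => X y 0) x]

/-- `(E, B)` is a smooth solution, for all times, of Maxwell's equations in free space. -/
structure IsMaxwell (E B : ℝ → R3 → R3) : Prop where
  smooth_E : ContDiff ℝ ∞ (fun q : ℝ × R3 => E q.1 q.2)
  smooth_B : ContDiff ℝ ∞ (fun q : ℝ × R3 => B q.1 q.2)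
  dt_E : ∀ t x, deriv (fun s => E s x) t = curl3 (B t) x
  dt_B : ∀ t x, deriv (fun s => B s x) t = -curl3 (E t) x
  div_E : ∀ t x, div3 (E t) x = 0
  div_B : ∀ t x, div3 (B t) x = 0

/-- The fields are orthogonal and have equal modulus at all times. -/
def IsNull (E B : ℝ → R3 → R3) : Prop :=
  ∀ t x, inner ℝ (E t x) (B t x) = 0 ∧ ‖E t x‖ = ‖B t x‖

/-! ### Bateman fields of Hopf type -/

/-- The common denominator `x² + y² + z² - (t - i)²`. -/
def den (t : ℝ) (x : R3) : ℂ :=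
  (x 0 : ℂ) ^ 2 + (x 1 : ℂ) ^ 2 + (x 2 : ℂ) ^ 2 - ((t : ℂ) - Complex.I) ^ 2

/-- The Bateman variable `α = (x² + y² + z² - t² - 1 + 2 i z) / (x² + y² + z² - (t - i)²)`. -/
def alpha (t : ℝ) (x : R3) : ℂ :=
  ((x 0 : ℂ) ^ 2 + (x 1 : ℂ) ^ 2 + (x 2 : ℂ) ^ 2 - (t : ℂ) ^ 2 - 1 + 2 * Complex.I * (x 2 : ℂ))
    / den t x

/-- The Bateman variable `β = 2 (x - i y) / (x² + y² + z² - (t - i)²)`. -/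
def beta (t : ℝ) (x : R3) : ℂ := 2 * ((x 0 : ℂ) - Complex.I * (x 1 : ℂ)) / den t x

/-- The map `(α, β)` at time `t`. -/
def hopfMap (t : ℝ) (x : R3) : C2 := !₂[alpha t x, beta t x]

/-- `|den|² = (x² + y² + z² - t² + 1)² + 4 t²`. -/
theorem normSq_den (t : ℝ) (x : R3) : Complex.normSq (den t x) =
    (x 0 ^ 2 + x 1 ^ 2 + x 2 ^ 2 - t ^ 2 + 1) ^ 2 + 4 * t ^ 2 := by
  simp [den, Complex.normSq_apply, pow_two]
  ring

theorem normSq_den_pos (t : ℝ) (x : R3) : 0 < Complex.normSq (den t x) := by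
  rw [normSq_den]
  by_cases ht : t = 0
  · have : 0 < x 0 ^ 2 + x 1 ^ 2 + x 2 ^ 2 - t ^ 2 + 1 := by
      subst ht
      nlinarith [sq_nonneg (x 0), sq_nonneg (x 1), sq_nonneg (x 2)]
    positivity
  · have : 0 < t ^ 2 := by positivity
    positivity

/-- The map `(α, β)` takes its values in `𝕊³`. -/
theorem hopfMap_mem (t : ℝ) (x : R3) : hopfMap t x ∈ Metric.sphere (0 : C2) 1 := by
  have hd := normSq_den_pos t x
  rw [mem_sphere_zero_iff_norm, EuclideanSpace.norm_eq, Real.sqrt_eq_one]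
  simp only [hopfMap, Fin.sum_univ_two, Complex.sq_norm, alpha, beta, map_div₀,
    Matrix.cons_val_zero, Matrix.cons_val_one]
  rw [← add_div, div_eq_one_iff_eq hd.ne', normSq_den]
  simp [Complex.normSq_apply, pow_two]
  ring

/-- `(α, β)` at time `t`, as a map to `𝕊³`. -/
def hopfMapS3 (t : ℝ) (x : R3) : S3 := ⟨hopfMap t x, hopfMap_mem t x⟩

/-- Spatial gradient of a complex-valued function. -/
def grad (f : R3 → ℂ) (x : R3) : Fin 3 → ℂ := fun i => pd i f x

/-- The Bateman field `F = h(α, β) ∇α × ∇β` of Hopf type. -/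
def batemanField (h : C2 → ℂ) (t : ℝ) (x : R3) : Fin 3 → ℂ :=
  h (hopfMap t x) • (grad (alpha t) x ⨯₃ grad (beta t) x)

/-- Electric part `E = Re F` of the Riemann-Silberstein vector `F = E + i B`. -/
def electric (F : ℝ → R3 → Fin 3 → ℂ) (t : ℝ) (x : R3) : R3 :=
  WithLp.toLp 2 (fun i => (F t x i).re)

/-- Magnetic part `B = Im F` of the Riemann-Silberstein vector `F = E + i B`. -/
def magnetic (F : ℝ → R3 → Fin 3 → ℂ) (t : ℝ) (x : R3) : R3 :=
  WithLp.toLp 2 (fun i => (F t x i).im)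

/-- The positive real factor, independent of the field, that appears in the pushforward:
`8 (1 + x² + y² + (z - t)²) / ((x² + y² + z² - t² + 1)² + 4 t²)²`. -/
def pushFactor (t : ℝ) (x : R3) : ℝ :=
  8 * (1 + x 0 ^ 2 + x 1 ^ 2 + (x 2 - t) ^ 2)
    / ((x 0 ^ 2 + x 1 ^ 2 + x 2 ^ 2 - t ^ 2 + 1) ^ 2 + 4 * t ^ 2) ^ 2

/-- For each time `t`, the pushforward by `(α, β)|ₜ` of the field `X t` on `ℝ³` is the field `X₀` on
`𝕊³`, up to the real factor `pushFactor`. -/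
def PushesForwardTo (X : ℝ → R3 → R3) (X₀ : S3 → C2) : Prop :=
  ∀ t x, fderiv ℝ (hopfMap t) x (X t x) = pushFactor t x • X₀ (hopfMapS3 t x)

/-- The fields `E₀`, `B₀` on `𝕊³` arise from a Bateman null solution of Hopf type: for some `h`
holomorphic on a neighbourhood of `𝕊³`, the field `F = h(α, β) ∇α × ∇β` is a null solution of
Maxwell's equations, `E₀ + i B₀ = h (v₁ + i v₂)` on `𝕊³`, and, up to the known real
factor, `(E₀, B₀)` is at each time the pushforward by `(α, β)` of the electric and magnetic parts
of `F`. -/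
def IsOfBatemanType (E₀ B₀ : S3 → C2) : Prop :=
  ∃ h : C2 → ℂ, IsHolomorphicNearS3 h ∧
    IsMaxwell (electric (batemanField h)) (magnetic (batemanField h)) ∧
    IsNull (electric (batemanField h)) (magnetic (batemanField h)) ∧
    IsRePart (fun p => h p) E₀ ∧ IsImPart (fun p => h p) B₀ ∧
    PushesForwardTo (electric (batemanField h)) E₀ ∧
    PushesForwardTo (magnetic (batemanField h)) B₀

end HopfBateman

end

open HopfBateman

/-!
# Hopf-type Bateman null solutions and tangential Cauchy-Riemann equations

Put `w z = v₁ z = (-conj z₂, conj z₁)`. Then `v₂ = i w`, and `w p` spans over `ℂ` the Hermitian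
complement of `p ∈ 𝕊³`, which is the contact plane at `p`. Hence a Legendrian field is
`X = conj f • w` for exactly one function `f`, its coefficient function, and everything is read
off `f`.

*Divergence.* With `A = df(w) + i df(i w)`, which is twice the tangential Cauchy-Riemann operator
applied to `f` (`Lbar_eq`), one finds `div X = Re A` and `div (J X) = Im A` (`divS3_eq`), because
`w` is divergence-free. So `X` and `J X` are divergence-free exactly when `f` is CR
(`isCR_iff_divS3`).

*Holomorphic extension.* A holomorphic extension of `f` gives the CR equations, as its derivative
is complex-linear on the complex line of `w`. Conversely, let `f` be real-analytic and CR. Near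
`p ∈ 𝕊³` it is `G (z, conj z)` for a holomorphic function `G (z, ζ)` (`exists_polarization`), and
the extension is `h z = G (z, conj z / |z|²)`. It is holomorphic once `K = -z₂ ∂G/∂ζ₁ + z₁ ∂G/∂ζ₂`
vanishes at the points `(z, conj z / |z|²)` (`differentiableAt_reflected`). These are the points
`(c q, c⁻¹ conj q)` with `q ∈ 𝕊³` and `c > 0`. For `|c| = 1` the number `K (c q, c⁻¹ conj q)` is
the value at `c q ∈ 𝕊³` of the CR operator applied to `f`, hence zero, and the identity theorem in
the one variable `c` makes it vanish for all `c` near `1` (`IsCR.exists_local_extension`). The same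
identity theorem on complex lines through the origin shows that the local extensions agree
(`IsCR.extendsHolomorphically`).

*Bateman fields.* With `a = z - t + i`, `b = x - i y` and `e = 1 / d` one has `α = 1 + 2 i a e`,
`β = 2 b e` and `∇α × ∇β = 4 e³ (a² - b², -i (a² + b²), -2 a b)` (`grad_cross_grad`). From this
formula, the Maxwell equations, nullity and the pushforward identity become polynomial identities
modulo `e d = 1` and `i² = -1`, for every `h` complex-differentiable at the points of `𝕊³`. As
`(α, β)` takes its values in `𝕊³`, smoothness of the field only uses that `h` is real-analytic on
`𝕊³`, which holds for the extension of a real-analytic coefficient function.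
-/

open Filter
open scoped Topology

noncomputable section

namespace HopfBateman

/-! ### Complexification of real-analytic functions -/

/-- In the coordinates of a real basis, a real-analytic function extends to a holomorphic function
of as many complex variables: each multilinear term of the power series is expanded in the basis
and read as a complex multilinear map. -/
theorem exists_complexification {ι E : Type*} [Fintype ι] [DecidableEq ι] [NormedAddCommGroup E]
    [NormedSpace ℝ E] [FiniteDimensional ℝ E] (b : Module.Basis ι ℝ E) {f : E → ℂ} {x : E}
    (hf : AnalyticAt ℝ f x) :
    ∃ F : (ι → ℂ) → ℂ, AnalyticAt ℂ F (fun j => (b.repr x j : ℂ)) ∧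
      ∀ᶠ y in 𝓝 x, F (fun j => (b.repr y j : ℂ)) = f y := by
  obtain ⟨p, r, hp⟩ := hf
  obtain ⟨C, ρ, hC, hρ, hpn⟩ := p.le_mul_pow_of_radius_pos (hp.r_pos.trans_le hp.r_le)
  set q : FormalMultilinearSeries ℂ (ι → ℂ) ℂ := fun n => ∑ j : Fin n → ι,
    p n (fun k => b (j k)) •
      (ContinuousMultilinearMap.mkPiAlgebra ℂ (Fin n) ℂ).compContinuousLinearMap
        (fun k => ContinuousLinearMap.proj (j k)) with hq
  set B : ℝ := ∑ i, ‖b i‖ with hB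
  have hB0 : 0 ≤ B := Finset.sum_nonneg fun i _ => norm_nonneg _
  have hBi : ∀ i, ‖b i‖ ≤ B := fun i =>
    Finset.single_le_sum (f := fun i => ‖b i‖) (fun i _ => norm_nonneg _) (Finset.mem_univ i)
  set d : ℝ := (Fintype.card ι : ℝ)
  have hd : 0 ≤ d := Nat.cast_nonneg _
  have hq_apply : ∀ n (m : Fin n → ι → ℂ),
      q n m = ∑ j : Fin n → ι, p n (fun k => b (j k)) * ∏ k, m k (j k) := by
    intro n m
    simp [hq]
  have hq_norm : ∀ n, ‖q n‖ ≤ C * (d * ρ * B) ^ n := by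
    intro n
    -- there are `d ^ n` terms, and each basis vector has norm at most `B`
    refine ContinuousMultilinearMap.opNorm_le_bound (by positivity) fun m => ?_
    rw [hq_apply]
    calc ‖∑ j : Fin n → ι, p n (fun k => b (j k)) * ∏ k, m k (j k)‖
        ≤ ∑ j : Fin n → ι, C * ρ ^ n * B ^ n * ∏ k, ‖m k‖ := by
          refine norm_sum_le_of_le _ fun j _ => ?_
          rw [norm_mul, norm_prod]
          have h1 : ‖p n (fun k => b (j k))‖ ≤ C * ρ ^ n * B ^ n := by
            refine ((p n).le_opNorm _).trans ?_
            have : ∏ k, ‖b (j k)‖ ≤ ∏ _k : Fin n, B :=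
              Finset.prod_le_prod (fun _ _ => norm_nonneg _) fun k _ => hBi _
            rw [Finset.prod_const, Finset.card_univ, Fintype.card_fin] at this
            exact mul_le_mul (hpn n) this (Finset.prod_nonneg fun _ _ => norm_nonneg _)
              (by positivity)
          have h2 : ∏ k, ‖m k (j k)‖ ≤ ∏ k, ‖m k‖ :=
            Finset.prod_le_prod (fun _ _ => norm_nonneg _) fun k _ => norm_le_pi_norm _ _
          exact mul_le_mul h1 h2 (Finset.prod_nonneg fun _ _ => norm_nonneg _) (by positivity)
      _ = C * (d * ρ * B) ^ n * ∏ k, ‖m k‖ := by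
          rw [Finset.sum_const, Finset.card_univ, Fintype.card_fun, Fintype.card_fin, nsmul_eq_mul]
          push_cast
          ring
  have hq_radius : 0 < q.radius := by
    set R : ℝ := (d * ρ * B + 1)⁻¹ with hR
    have hR0 : 0 < R := by positivity
    have h := q.le_radius_of_bound C (r := ⟨R, hR0.le⟩) fun n => by
      calc ‖q n‖ * R ^ n ≤ C * (d * ρ * B) ^ n * R ^ n := by gcongr; exact hq_norm n
        _ = C * (d * ρ * B * R) ^ n := by ring
        _ ≤ C * 1 := by
          gcongr
          refine pow_le_one₀ (by positivity) ?_
          rw [hR, ← div_eq_mul_inv, div_le_one (by positivity)]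
          linarith
        _ = C := mul_one C
    refine lt_of_lt_of_le ?_ h
    exact ENNReal.coe_pos.2 hR0
  have hq_real : ∀ n (v : E), q n (fun _ j => (b.repr v j : ℂ)) = p n (fun _ => v) := by
    intro n v
    rw [hq_apply]
    conv_rhs => rw [← b.sum_repr v, (p n).map_sum]
    refine Finset.sum_congr rfl fun j _ => ?_
    rw [(p n).map_smul_univ, Complex.real_smul, mul_comm]
    push_cast
    rfl
  refine ⟨fun z => q.sum (z - fun j => (b.repr x j : ℂ)), ?_, ?_⟩
  · have h1 : AnalyticAt ℂ q.sum ((fun j => (b.repr x j : ℂ)) - fun j => (b.repr x j : ℂ)) := by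
      rw [sub_self]
      exact (q.hasFPowerSeriesOnBall hq_radius).analyticAt
    exact h1.comp (f := fun z : ι → ℂ => z - fun j => (b.repr x j : ℂ))
      (analyticAt_id.sub analyticAt_const)
  · have hmem : ∀ᶠ y in 𝓝 x, y ∈ Metric.eball x r := Metric.eball_mem_nhds x hp.r_pos
    filter_upwards [hmem] with y hy
    have hy' : y - x ∈ Metric.eball (0 : E) r := by
      rw [Metric.mem_eball, edist_eq_enorm_sub] at hy ⊢
      simpa using hy
    have h := (hp.hasSum hy').tsum_eq
    rw [add_sub_cancel] at h
    rw [← h, FormalMultilinearSeries.sum]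
    congr 1
    ext n
    rw [← hq_real n (y - x)]
    congr 1
    ext k j
    simp

/-! ### Radial extension -/

/-- The normalisation `z ↦ z / |z|` is real-analytic from the punctured space to `𝕊³`. -/
theorem contMDiff_toSphere : ContMDiff 𝓘(ℝ, C2) (𝓡 3) ω
    (fun z : (⟨{0}ᶜ, isOpen_compl_singleton⟩ : TopologicalSpace.Opens C2) =>
      toSphere (z : C2) z.2) := by
  refine ContMDiff.codRestrict_sphere (m := ω) (n := 3) (I := 𝓘(ℝ, C2))
    (f := fun z : (⟨{0}ᶜ, isOpen_compl_singleton⟩ : TopologicalSpace.Opens C2) =>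
      (‖(z : C2)‖⁻¹ : ℝ) • (z : C2)) ?_ _
  intro z
  refine (contMDiffAt_subtype_iff (I := 𝓘(ℝ, C2)) (f := fun z : C2 => (‖z‖⁻¹ : ℝ) • z)).2
    (ContDiffAt.contMDiffAt ?_)
  have h0 : (z : C2) ≠ 0 := z.2
  exact ((contDiffAt_norm ℝ h0).inv (norm_ne_zero_iff.2 h0)).smul contDiffAt_id

theorem analyticAt_radialExt {V : Type} [NormedAddCommGroup V] [NormedSpace ℝ V] [CompleteSpace V]
    {f : S3 → V} (hf : IsRealAnalytic f) {z : C2} (hz : z ≠ 0) :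
    AnalyticAt ℝ (radialExt f) z := by
  refine ContDiffAt.analyticAt ?_
  rw [← contMDiffAt_iff_contDiffAt]
  have h := (hf.comp contMDiff_toSphere) ⟨z, hz⟩
  refine (contMDiffAt_subtype_iff (U := ⟨{0}ᶜ, isOpen_compl_singleton⟩)
    (f := radialExt f) (x := ⟨z, hz⟩)).1 ?_
  refine h.congr_of_eventuallyEq (Eventually.of_forall fun y => ?_)
  have : (y : C2) ≠ 0 := y.2
  simp [radialExt, this]

/-! ### Legendrian fields and their coefficient functions -/

theorem v₁_zero (z : C2) : v₁ z 0 = -conj (z 1) := by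
  apply Complex.ext <;> simp [v₁]

theorem v₁_one (z : C2) : v₁ z 1 = conj (z 0) := by
  apply Complex.ext <;> simp [v₁]

theorem v₂_eq (z : C2) : v₂ z = Complex.I • v₁ z := by
  ext j
  fin_cases j <;> apply Complex.ext <;> simp [v₁, v₂]

/-- The Hopf field `v₁`, which is conjugate-linear, as a real-linear map. -/
def v₁L : C2 →L[ℝ] C2 := LinearMap.toContinuousLinearMap
  { toFun := v₁
    map_add' := fun z w => by
      ext j
      fin_cases j <;> simp [v₁_zero, v₁_one, add_comm]
    map_smul' := fun c z => by
      ext j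
      fin_cases j <;> simp [v₁_zero, v₁_one] }

@[simp]
theorem v₁L_apply (z : C2) : v₁L z = v₁ z := rfl

theorem S3_mul_conj (p : S3) :
    (p : C2) 0 * conj ((p : C2) 0) + (p : C2) 1 * conj ((p : C2) 1) = 1 := by
  have h : ‖(p : C2)‖ ^ 2 = 1 := by rw [mem_sphere_zero_iff_norm.1 p.2, one_pow]
  rw [EuclideanSpace.norm_sq_eq, Fin.sum_univ_two] at h
  rw [Complex.mul_conj', Complex.mul_conj', ← Complex.ofReal_pow, ← Complex.ofReal_pow,
    ← Complex.ofReal_add, h, Complex.ofReal_one]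

theorem isRePart_iff {f : S3 → ℂ} {X : S3 → C2} :
    IsRePart f X ↔ ∀ p : S3, X p = conj (f p) • v₁ p := by
  refine forall_congr' fun p => ?_
  have : (f p).re • v₁ p - (f p).im • v₂ p = conj (f p) • v₁ (p : C2) := by
    ext j
    rw [v₂_eq]
    apply Complex.ext
    · simp
    · simp
      ring
  rw [this]

theorem isImPart_iff {f : S3 → ℂ} {X : S3 → C2} :
    IsImPart f X ↔ ∀ p : S3, X p = (Complex.I * conj (f p)) • v₁ p := by
  refine forall_congr' fun p => ?_
  have : (f p).im • v₁ p + (f p).re • v₂ p = (Complex.I * conj (f p)) • v₁ (p : C2) := by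
    ext j
    rw [v₂_eq]
    apply Complex.ext
    · simp
      ring
    · simp
  rw [this]

theorem IsRePart.isImPart_J {f : S3 → ℂ} {X : S3 → C2} (h : IsRePart f X) : IsImPart f (J X) := by
  rw [isImPart_iff]
  intro p
  rw [J, isRePart_iff.1 h p, smul_smul]

/-- The coefficient function is the complex conjugate of the Hermitian product of `v₁` with the
field. -/
theorem IsRePart.eq_coeff {f : S3 → ℂ} {X : S3 → C2} (h : IsRePart f X) (p : S3) :
    f p = conj (-(p : C2) 1 * X p 0 + (p : C2) 0 * X p 1) := by
  have h1 := S3_mul_conj p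
  rw [isRePart_iff.1 h p]
  simp only [PiLp.smul_apply, v₁_zero, v₁_one, smul_eq_mul, map_add, map_mul, map_neg,
    Complex.conj_conj]
  linear_combination (-f p) * h1

theorem IsRePart.unique {f g : S3 → ℂ} {X : S3 → C2} (hf : IsRePart f X) (hg : IsRePart g X) :
    f = g :=
  funext fun p => (hf.eq_coeff p).trans (hg.eq_coeff p).symm

theorem IsLegendrian.exists_isRePart {X : S3 → C2} (h : IsLegendrian X) :
    ∃ f : S3 → ℂ, IsRePart f X := by
  refine ⟨fun p => conj (-(p : C2) 1 * X p 0 + (p : C2) 0 * X p 1), isRePart_iff.2 fun p => ?_⟩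
  have h1 := S3_mul_conj p
  obtain ⟨hi, hc⟩ := h p
  -- tangency and the contact condition are the real and imaginary parts of one equation
  have h2 : conj ((p : C2) 0) * X p 0 + conj ((p : C2) 1) * X p 1 = 0 := by
    apply Complex.ext
    · simp [PiLp.inner_apply, Complex.inner] at hi
      simp
      linarith
    · simp [contactForm] at hc
      simp
      linarith
  ext j
  fin_cases j
  · simp [v₁_zero]
    linear_combination (-X p 0) * h1 + (p : C2) 0 * h2
  · simp [v₁_one]
    linear_combination (-X p 1) * h1 + (p : C2) 1 * h2

theorem IsRePart.isRealAnalytic {f : S3 → ℂ} {X : S3 → C2} (h : IsRePart f X)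
    (hX : IsRealAnalytic X) : IsRealAnalytic f := by
  have hΨ : ContDiff ℝ ω fun q : C2 × C2 =>
      conj (-q.1 1 * q.2 0 + q.1 0 * q.2 1 : ℂ) := by
    have h1 : ∀ j : Fin 2, ContDiff ℝ ω fun q : C2 × C2 => (q.1 j : ℂ) := fun j =>
      ((EuclideanSpace.proj (𝕜 := ℂ) (ι := Fin 2) j : C2 →L[ℂ] ℂ).restrictScalars ℝ).contDiff.comp
        contDiff_fst
    have h2 : ∀ j : Fin 2, ContDiff ℝ ω fun q : C2 × C2 => (q.2 j : ℂ) := fun j =>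
      ((EuclideanSpace.proj (𝕜 := ℂ) (ι := Fin 2) j : C2 →L[ℂ] ℂ).restrictScalars ℝ).contDiff.comp
        contDiff_snd
    exact Complex.conjCLE.contDiff.comp (((h1 1).neg.mul (h2 0)).add ((h1 0).mul (h2 1)))
  have hcoe : ContMDiff (𝓡 3) 𝓘(ℝ, C2) ω ((↑) : S3 → C2) := contMDiff_coe_sphere
  have := hΨ.contMDiff.comp (hcoe.prodMk_space hX)
  rw [IsRealAnalytic, show f = _ from funext h.eq_coeff]
  exact this

theorem realLinear_apply (ℓ : C2 →L[ℝ] ℂ) (v : C2) :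
    ℓ v = (v 0).re * ℓ (EuclideanSpace.single 0 1)
      + (v 0).im * ℓ (EuclideanSpace.single 0 Complex.I)
      + (v 1).re * ℓ (EuclideanSpace.single 1 1)
      + (v 1).im * ℓ (EuclideanSpace.single 1 Complex.I) := by
  have hv : v = (v 0).re • EuclideanSpace.single 0 (1 : ℂ)
      + (v 0).im • EuclideanSpace.single 0 Complex.I
      + (v 1).re • EuclideanSpace.single 1 (1 : ℂ)
      + (v 1).im • EuclideanSpace.single 1 Complex.I := by
    ext j
    fin_cases j <;> apply Complex.ext <;> simp
  conv_lhs => rw [hv]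
  simp only [map_add, map_smul, Complex.real_smul]

/-- The real basis of `ℂ²`: `(j, 0)` indexes the `j`-th unit vector and `(j, 1)` its multiple by
`i`. -/
def realBasis : Module.Basis (Fin 2 × Fin 2) ℝ C2 :=
  Complex.basisOneI.smulTower' (EuclideanSpace.basisFun (Fin 2) ℂ).toBasis

theorem realBasis_repr_zero (z : C2) (j : Fin 2) : realBasis.repr z (j, 0) = (z j).re := by
  simp [realBasis, Module.Basis.smulTower'_repr]

theorem realBasis_repr_one (z : C2) (j : Fin 2) : realBasis.repr z (j, 1) = (z j).im := by
  simp [realBasis, Module.Basis.smulTower'_repr]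

theorem realBasis_zero (j : Fin 2) : realBasis (j, 0) = EuclideanSpace.single j 1 := by
  simp [realBasis, Module.Basis.smulTower'_apply]

theorem realBasis_one (j : Fin 2) : realBasis (j, 1) = EuclideanSpace.single j Complex.I := by
  ext k
  simp [realBasis, Module.Basis.smulTower'_apply]

theorem trace_C2 (L : C2 →ₗ[ℝ] C2) :
    LinearMap.trace ℝ C2 L = (L (EuclideanSpace.single 0 1) 0).re
      + (L (EuclideanSpace.single 0 Complex.I) 0).im
      + (L (EuclideanSpace.single 1 1) 1).re
      + (L (EuclideanSpace.single 1 Complex.I) 1).im := by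
  rw [LinearMap.trace_eq_matrix_trace ℝ realBasis, Matrix.trace, Fintype.sum_prod_type]
  simp [LinearMap.toMatrix_apply, Fin.sum_univ_two, realBasis_repr_zero, realBasis_repr_one,
    realBasis_zero, realBasis_one]
  ring

/-- The vectors `w = v₁ p` and `i w` span the contact plane, and `2 L̄ f = df(w) + i df(i w)`. -/
theorem Lbar_eq (f : S3 → ℂ) (p : S3) :
    2 * Lbar f p = fderiv ℝ (radialExt f) p (v₁ p)
      + Complex.I * fderiv ℝ (radialExt f) p (Complex.I • v₁ p) := by
  rw [realLinear_apply _ (v₁ p), realLinear_apply _ (Complex.I • v₁ p), Lbar, dzbar, dzbar]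
  generalize fderiv ℝ (radialExt f) (p : C2) = ℓ
  have h0 := Complex.re_add_im ((p : C2) 0)
  have h1 := Complex.re_add_im ((p : C2) 1)
  simp only [PiLp.smul_apply, v₁_zero, v₁_one, smul_eq_mul, Complex.mul_re, Complex.mul_im,
    Complex.neg_re, Complex.neg_im, Complex.conj_re, Complex.conj_im, Complex.I_re, Complex.I_im]
  push_cast
  linear_combination (ℓ (EuclideanSpace.single 0 1)
    + Complex.I * ℓ (EuclideanSpace.single 0 Complex.I)) * h1
    - (ℓ (EuclideanSpace.single 1 1)
    + Complex.I * ℓ (EuclideanSpace.single 1 Complex.I)) * h0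
    + (ℓ (EuclideanSpace.single 1 Complex.I) * ((p : C2) 0).im
    - ℓ (EuclideanSpace.single 0 Complex.I) * ((p : C2) 1).im) * Complex.I_sq

/-! ### Polarization, and reflection in the sphere -/

theorem radialExt_coe {V : Type} [NormedAddCommGroup V] (f : S3 → V) (p : S3) :
    radialExt f (p : C2) = f p := by
  have h : (p : C2) ≠ 0 := ne_zero_of_mem_unit_sphere p
  rw [radialExt, dif_neg h]
  congr 1
  ext1
  simp [toSphere]

/-- Coordinatewise complex conjugation of `ℂ²`, as a real-linear map. -/
def conjL : C2 →L[ℝ] C2 := LinearMap.toContinuousLinearMap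
  { toFun := fun z => !₂[conj (z 0), conj (z 1)]
    map_add' := fun z w => by
      ext j
      fin_cases j <;> simp
    map_smul' := fun c z => by
      ext j
      fin_cases j <;> simp }

@[simp]
theorem conjL_apply (z : C2) (j : Fin 2) : conjL z j = conj (z j) := by
  fin_cases j <;> rfl

theorem conjL_smul (c : ℂ) (z : C2) : conjL (c • z) = conj c • conjL z := by
  ext j
  simp

theorem conjL_single (j : Fin 2) (c : ℂ) :
    conjL (EuclideanSpace.single j c) = EuclideanSpace.single j (conj c) := by
  ext k
  by_cases h : k = j <;> simp [h]

/-- A real-analytic function near `p` is the restriction to `ζ = conj z` of a function of `(z, ζ)`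
holomorphic near `(p, conj p)`. -/
theorem exists_polarization {f : C2 → ℂ} {p : C2} (hf : AnalyticAt ℝ f p) :
    ∃ G : C2 × C2 → ℂ, AnalyticAt ℂ G (p, conjL p) ∧ ∀ᶠ z in 𝓝 p, G (z, conjL z) = f z := by
  obtain ⟨F, hF, hFf⟩ := exists_complexification realBasis hf
  -- the coordinates `x = (z + ζ) / 2` and `y = (z - ζ) / (2 i)`
  let Φ : C2 × C2 →L[ℂ] (Fin 2 × Fin 2 → ℂ) := LinearMap.toContinuousLinearMap
    { toFun := fun q j =>
        if j.2 = 0 then (q.1 j.1 + q.2 j.1) / 2 else -(Complex.I / 2) * (q.1 j.1 - q.2 j.1)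
      map_add' := fun q q' => by
        ext ⟨j, k⟩
        fin_cases k <;> simp <;> ring
      map_smul' := fun c q => by
        ext ⟨j, k⟩
        fin_cases k <;> simp <;> ring }
  have hΦ : ∀ z, Φ (z, conjL z) = fun j => (realBasis.repr z j : ℂ) := by
    intro z
    ext ⟨j, k⟩
    fin_cases k
    · change (z j + conjL z j) / 2 = (realBasis.repr z (j, 0) : ℂ)
      rw [realBasis_repr_zero, Complex.re_eq_add_conj, conjL_apply]
    · change -(Complex.I / 2) * (z j - conjL z j) = (realBasis.repr z (j, 1) : ℂ)
      rw [realBasis_repr_one, Complex.im_eq_sub_conj, conjL_apply]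
      field_simp
      rw [Complex.I_sq]
      ring
  refine ⟨F ∘ Φ, ?_, ?_⟩
  · refine AnalyticAt.comp ?_ (Φ.analyticAt _)
    rwa [hΦ]
  · filter_upwards [hFf] with z hz
    rw [Function.comp_apply, hΦ, hz]

/-- If `f z = G (z, conj z)` with `G` holomorphic in `(z, ζ)`, then `∂f/∂z̄ⱼ` is `∂G/∂ζⱼ`. -/
theorem dzbar_polarization {f : C2 → ℂ} {G : C2 × C2 → ℂ} {z : C2}
    (hG : DifferentiableAt ℂ G (z, conjL z)) (hf : ∀ᶠ y in 𝓝 z, G (y, conjL y) = f y)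
    (j : Fin 2) :
    dzbar j f z = fderiv ℂ G (z, conjL z) (0, EuclideanSpace.single j 1) := by
  have h1 : HasFDerivAt (fun y => G (y, conjL y))
      (((fderiv ℂ G (z, conjL z)).restrictScalars ℝ).comp
        ((ContinuousLinearMap.id ℝ C2).prod conjL)) z :=
    HasFDerivAt.comp (𝕜 := ℝ) z (hG.hasFDerivAt.restrictScalars ℝ)
      ((hasFDerivAt_id z).prodMk conjL.hasFDerivAt)
  have h2 : HasFDerivAt f _ z := h1.congr_of_eventuallyEq (hf.mono fun y hy => hy.symm)
  rw [dzbar, h2.fderiv]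
  have hs : EuclideanSpace.single j Complex.I = Complex.I • EuclideanSpace.single j (1 : ℂ) := by
    ext k
    simp
  generalize fderiv ℂ G (z, conjL z) = D
  have e1 : D (EuclideanSpace.single j 1, EuclideanSpace.single j 1)
      = D (EuclideanSpace.single j 1, 0) + D (0, EuclideanSpace.single j 1) := by
    rw [← map_add]
    simp
  have e2 : D (EuclideanSpace.single j Complex.I, conjL (EuclideanSpace.single j Complex.I))
      = Complex.I * D (EuclideanSpace.single j 1, 0)
        - Complex.I * D (0, EuclideanSpace.single j 1) := by
    rw [hs, conjL_smul, conjL_single, Complex.conj_I, map_one, ← smul_eq_mul, ← smul_eq_mul,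
      ← map_smul, ← map_smul, ← map_sub]
    simp
  simp only [ContinuousLinearMap.comp_apply, ContinuousLinearMap.prod_apply,
    ContinuousLinearMap.coe_restrictScalars', ContinuousLinearMap.id_apply, conjL_single, map_one,
    e1]
  rw [← conjL_single, e2]
  linear_combination (D (EuclideanSpace.single j 1, 0) - D (0, EuclideanSpace.single j 1)) / 2
    * Complex.I_sq

/-- A real-differentiable function whose derivative commutes with `i` is complex-differentiable. -/
theorem differentiableAt_complex_of_fderiv_I_smul {E : Type*} [NormedAddCommGroup E]
    [NormedSpace ℂ E] {f : E → ℂ} {x : E} (hf : DifferentiableAt ℝ f x)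
    (h : ∀ v, fderiv ℝ f x (Complex.I • v) = Complex.I * fderiv ℝ f x v) :
    DifferentiableAt ℂ f x := by
  refine (differentiableAt_iff_restrictScalars ℝ hf).2
    ⟨{ toFun := fderiv ℝ f x
       map_add' := map_add _
       map_smul' := fun c v => ?_
       cont := (fderiv ℝ f x).cont }, rfl⟩
  have : c • v = c.re • v + c.im • Complex.I • v := by
    conv_lhs => rw [← Complex.re_add_im c, add_smul, mul_smul]
    rfl
  rw [this, map_add, map_smul, map_smul, h]
  simp only [Complex.real_smul, RingHom.id_apply, smul_eq_mul]
  linear_combination fderiv ℝ f x v * Complex.re_add_im c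

/-- The complex number `z · conj z = |z|²`. -/
def hermSq (z : C2) : ℂ := z 0 * conj (z 0 : ℂ) + z 1 * conj (z 1 : ℂ)

theorem hermSq_eq_norm_sq (z : C2) : hermSq z = (‖z‖ ^ 2 : ℝ) := by
  rw [EuclideanSpace.norm_sq_eq, Fin.sum_univ_two, hermSq, Complex.mul_conj', Complex.mul_conj']
  push_cast
  rfl

theorem hermSq_ne_zero {z : C2} (hz : z ≠ 0) : hermSq z ≠ 0 := by
  rw [hermSq_eq_norm_sq]
  exact_mod_cast pow_ne_zero 2 (norm_ne_zero_iff.2 hz)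

theorem exists_hasFDerivAt_inv_hermSq {z : C2} (hz : z ≠ 0) :
    ∃ L : C2 →L[ℝ] ℂ, HasFDerivAt (fun y => (hermSq y)⁻¹) L z ∧
      ∀ v, L v = -(z 0 * conj (v 0 : ℂ) + v 0 * conj (z 0 : ℂ) + z 1 * conj (v 1 : ℂ)
        + v 1 * conj (z 1 : ℂ)) / hermSq z ^ 2 := by
  let π : Fin 2 → C2 →L[ℝ] ℂ := fun j =>
    (EuclideanSpace.proj (𝕜 := ℂ) (ι := Fin 2) j : C2 →L[ℂ] ℂ).restrictScalars ℝ
  let κ : Fin 2 → C2 →L[ℝ] ℂ := fun j => (Complex.conjCLE : ℂ →L[ℝ] ℂ).comp (π j)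
  have hN : HasFDerivAt hermSq _ z :=
    ((π 0).hasFDerivAt.mul (κ 0).hasFDerivAt).add ((π 1).hasFDerivAt.mul (κ 1).hasFDerivAt)
  refine ⟨_, ((hasFDerivAt_inv (hermSq_ne_zero hz)).restrictScalars ℝ).comp z hN, fun v => ?_⟩
  simp [π, κ]
  ring

/-- Complex differentiability of `z ↦ G (z, conj z / |z|²)`. For the second argument `u`, the
vector `du(i v) - i du(v)` is orthogonal to `z` for the bilinear product of `ℂ²`, so it is a
multiple of `(-z₂, z₁)`, and `hK` says that the derivative of `G` in `ζ` vanishes on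
that vector. -/
theorem differentiableAt_reflected {G : C2 × C2 → ℂ} {z : C2} (hz : z ≠ 0)
    (hG : DifferentiableAt ℂ G (z, (hermSq z)⁻¹ • conjL z))
    (hK : -z 1 * fderiv ℂ G (z, (hermSq z)⁻¹ • conjL z) (0, EuclideanSpace.single 0 1)
      + z 0 * fderiv ℂ G (z, (hermSq z)⁻¹ • conjL z) (0, EuclideanSpace.single 1 1) = 0) :
    DifferentiableAt ℂ (fun y : C2 => G (y, (hermSq y)⁻¹ • conjL y)) z := by
  obtain ⟨L, hL, hLv⟩ := exists_hasFDerivAt_inv_hermSq hz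
  have hN := hermSq_ne_zero hz
  have hh : HasFDerivAt (fun y : C2 => G (y, (hermSq y)⁻¹ • conjL y)) _ z :=
    HasFDerivAt.comp (𝕜 := ℝ) z (hG.hasFDerivAt.restrictScalars ℝ)
      ((hasFDerivAt_id z).prodMk (hL.smul conjL.hasFDerivAt))
  refine differentiableAt_complex_of_fderiv_I_smul hh.differentiableAt fun v => ?_
  rw [hh.fderiv]
  generalize fderiv ℂ G (z, (hermSq z)⁻¹ • conjL z) = D at hK
  have hD2 : ∀ a b : C2, D (a, b) = D (a, 0) + b 0 * D (0, EuclideanSpace.single 0 1)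
      + b 1 * D (0, EuclideanSpace.single 1 1) := by
    intro a b
    rw [← smul_eq_mul, ← smul_eq_mul, ← map_smul, ← map_smul, ← map_add, ← map_add]
    congr 1
    ext j
    · simp
    · fin_cases j <;> simp
  have hD1 : ∀ a : C2, D (Complex.I • a, 0) = Complex.I * D (a, 0) := by
    intro a
    rw [← smul_eq_mul, ← map_smul]
    simp
  simp only [ContinuousLinearMap.comp_apply, ContinuousLinearMap.prod_apply,
    ContinuousLinearMap.coe_restrictScalars', ContinuousLinearMap.id_apply,
    add_apply, smul_apply,
    ContinuousLinearMap.smulRight_apply]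
  rw [hD2, hD2 v, hD1]
  simp [hLv]
  generalize D (0, EuclideanSpace.single 0 1) = D0 at *
  generalize D (0, EuclideanSpace.single 1 1) = D1 at *
  field_simp
  rw [hermSq]
  -- up to scalars, `-conj z₂ conj v₁ + conj z₁ conj v₂` is the coefficient of `(-z₂, z₁)`
  linear_combination (-2 * (-conj (z 1 : ℂ) * conj (v 0 : ℂ)
    + conj (z 0 : ℂ) * conj (v 1 : ℂ))) * hK

/-! ### Holomorphic extension of real-analytic CR functions -/

theorem frequently_norm_eq_one : ∃ᶠ c in 𝓝[≠] (1 : ℂ), ‖c‖ = 1 := by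
  have hd : HasDerivAt (fun θ : ℝ => Complex.exp (θ * Complex.I)) Complex.I 0 := by
    have h := ((Complex.ofRealCLM.hasDerivAt (x := 0)).mul_const Complex.I).cexp
    simpa using h
  have ht := hd.tendsto_nhdsNE Complex.I_ne_zero
  simp only [Complex.ofReal_zero, zero_mul, Complex.exp_zero] at ht
  exact ht.frequently (Eventually.frequently
    (Eventually.of_forall fun θ => Complex.norm_exp_ofReal_mul_I θ))

/-- The identity theorem with the points of the unit circle near `1` as zero set. -/
theorem eqOn_zero_of_unit_circle {k : ℂ → ℂ} {U : Set ℂ} (hU : IsOpen U) (hUc : IsPreconnected U)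
    (h1 : (1 : ℂ) ∈ U) (hk : DifferentiableOn ℂ k U) (h : ∀ c ∈ U, ‖c‖ = 1 → k c = 0) :
    Set.EqOn k 0 U := by
  refine (hk.analyticOnNhd hU).eqOn_of_preconnected_of_frequently_eq
    (analyticOnNhd_const (v := (0 : ℂ))) hUc h1 ?_
  refine (frequently_norm_eq_one.and_eventually
    (mem_nhdsWithin_of_mem_nhds (hU.mem_nhds h1))).mono fun c hc => ?_
  exact h c hc.2 hc.1

theorem abs_norm_sub_one_le (p : S3) (z : C2) : |‖z‖ - 1| ≤ dist z p := by
  have h := abs_norm_sub_norm_le z (p : C2)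
  rwa [mem_sphere_zero_iff_norm.1 p.2, ← dist_eq_norm] at h

theorem ne_zero_of_dist_lt_one {p : S3} {z : C2} (h : dist z p < 1) : z ≠ 0 := by
  rintro rfl
  rw [dist_comm, dist_zero_right, mem_sphere_zero_iff_norm.1 p.2] at h
  exact lt_irrefl 1 h

theorem norm_smul_toSphere {z : C2} (hz : z ≠ 0) : ((‖z‖ : ℝ) : ℂ) • (toSphere z hz : C2) = z := by
  have : ‖z‖ ≠ 0 := norm_ne_zero_iff.2 hz
  change ‖z‖ • ‖z‖⁻¹ • z = z
  rw [smul_smul, mul_inv_cancel₀ this, one_smul]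

theorem dist_toSphere_le (p : S3) {z : C2} (hz : z ≠ 0) :
    dist (toSphere z hz : C2) p ≤ 2 * dist z p := by
  have h1 : dist (toSphere z hz : C2) z ≤ dist z p := by
    refine le_trans (le_of_eq ?_) (abs_norm_sub_one_le p z)
    have h2 : (toSphere z hz : C2) - z = (1 - ‖z‖) • (toSphere z hz : C2) := by
      rw [sub_smul, one_smul]
      exact congrArg (_ - ·) (norm_smul_toSphere hz).symm
    rw [dist_eq_norm, h2, norm_smul, mem_sphere_zero_iff_norm.1 (toSphere z hz).2, mul_one,
      Real.norm_eq_abs, abs_sub_comm]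
  linarith [dist_triangle (toSphere z hz : C2) z p]

theorem hermSq_S3 (p : S3) : hermSq (p : C2) = 1 := S3_mul_conj p

theorem hermSq_smul (c : ℂ) (z : C2) : hermSq (c • z) = c * conj c * hermSq z := by
  simp [hermSq]
  ring

/-- A real-analytic CR function extends holomorphically near each point `p` of the sphere, to a
ball of radius at most `1`, which therefore does not contain the origin. -/
theorem IsCR.exists_local_extension {f : S3 → ℂ} (hf : IsRealAnalytic f) (hCR : IsCR f) (p : S3) :
    ∃ r : ℝ, 0 < r ∧ r ≤ 1 ∧ ∃ h : C2 → ℂ, DifferentiableOn ℂ h (Metric.ball (p : C2) r) ∧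
      ∀ q : S3, (q : C2) ∈ Metric.ball (p : C2) r → h q = f q := by
  obtain ⟨G, hG, hGf⟩ := exists_polarization
    (analyticAt_radialExt hf (ne_zero_of_mem_unit_sphere p))
  set K : C2 × C2 → ℂ := fun w => -w.1 1 * fderiv ℂ G w (0, EuclideanSpace.single 0 1)
    + w.1 0 * fderiv ℂ G w (0, EuclideanSpace.single 1 1) with hKdef
  have hK : AnalyticAt ℂ K (p, conjL p) := by
    have hc : ∀ j : Fin 2, AnalyticAt ℂ (fun w : C2 × C2 => (w.1 j : ℂ)) (p, conjL p) := fun j =>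
      ((EuclideanSpace.proj (𝕜 := ℂ) (ι := Fin 2) j : C2 →L[ℂ] ℂ).comp
        (ContinuousLinearMap.fst ℂ C2 C2)).analyticAt _
    have hD : ∀ v : C2 × C2, AnalyticAt ℂ (fun w => fderiv ℂ G w v) (p, conjL p) := fun v =>
      ((ContinuousLinearMap.apply ℂ ℂ v).analyticAt _).comp hG.fderiv
    exact ((hc 1).neg.mul (hD _)).add ((hc 0).mul (hD _))
  set m : ℂ × C2 → C2 × C2 := fun x => (x.1 • x.2, x.1⁻¹ • conjL x.2) with hm
  have hm1 : m (1, p) = (↑p, conjL p) := by simp [hm]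
  have hmc : ContinuousAt m (1, (p : C2)) := by
    have h1 : ContinuousAt (fun x : ℂ × C2 => x.1⁻¹) (1, (p : C2)) :=
      continuousAt_fst.inv₀ one_ne_zero
    exact (continuousAt_fst.smul continuousAt_snd).prodMk
      (h1.smul (conjL.continuous.continuousAt.comp continuousAt_snd))
  have hev : ∀ᶠ x in 𝓝 ((1 : ℂ), (p : C2)), (AnalyticAt ℂ G (m x) ∧ AnalyticAt ℂ K (m x)) ∧
      ∀ᶠ y in 𝓝 (x.1 • x.2), G (y, conjL y) = radialExt f y := by
    refine Eventually.and ?_ ?_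
    · have h := hmc.tendsto
      rw [hm1] at h
      exact h.eventually (hG.eventually_analyticAt.and hK.eventually_analyticAt)
    · have h : Tendsto (fun x : ℂ × C2 => x.1 • x.2) (𝓝 ((1 : ℂ), (p : C2))) (𝓝 (p : C2)) := by
        have h : ContinuousAt (fun x : ℂ × C2 => x.1 • x.2) (1, (p : C2)) :=
          (continuous_fst.smul continuous_snd).continuousAt
        simpa only [ContinuousAt, one_smul] using h
      exact h.eventually hGf.eventually_nhds
  obtain ⟨δ, hδ, hball⟩ := Metric.eventually_nhds_iff_ball.1 hev
  have hball' : ∀ (c : ℂ) (q : C2), dist c 1 < δ → dist q p < δ →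
      (AnalyticAt ℂ G (m (c, q)) ∧ AnalyticAt ℂ K (m (c, q))) ∧
      ∀ᶠ y in 𝓝 (c • q), G (y, conjL y) = radialExt f y := fun c q hc hq =>
    hball (c, q) (by simpa [Prod.dist_eq] using ⟨hc, hq⟩)
  -- a disc of radius at most `1` around `1` does not contain `c = 0`
  set ε : ℝ := min δ 1 with hε
  have hε0 : 0 < ε := lt_min hδ one_pos
  -- the circle `|c| = 1` is mapped to the points `(z, conj z)` with `z ∈ 𝕊³`, where `K` is `L̄ f`
  have hK0 : ∀ (c : ℂ) (q : S3), dist c 1 < ε → dist (q : C2) p < δ → K (m (c, q)) = 0 := by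
    intro c q hc hq
    refine eqOn_zero_of_unit_circle (k := fun c => K (m (c, q))) Metric.isOpen_ball
      (convex_ball (1 : ℂ) ε).isPreconnected (Metric.mem_ball_self hε0) ?_ ?_
      (Metric.mem_ball.2 hc)
    · intro c hc
      rw [Metric.mem_ball] at hc
      have hc0 : c ≠ 0 := by
        rintro rfl
        have := hc.trans_le (min_le_right _ _)
        simp at this
      have hmd : DifferentiableAt ℂ (fun c : ℂ => m (c, (q : C2))) c :=
        (differentiableAt_id.smul_const _).prodMk
          ((differentiableAt_inv hc0).smul_const (conjL (q : C2)))
      exact ((hball' c q (hc.trans_le (min_le_left _ _)) hq).1.2.differentiableAt.comp c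
        hmd).differentiableWithinAt
    · intro c hc hc1
      obtain ⟨⟨hGan, -⟩, hGfc⟩ := hball' c q ((Metric.mem_ball.1 hc).trans_le (min_le_left _ _)) hq
      have hmem : c • (q : C2) ∈ Metric.sphere (0 : C2) 1 := by
        rw [mem_sphere_zero_iff_norm, norm_smul, hc1, one_mul, mem_sphere_zero_iff_norm.1 q.2]
      have hmc : m (c, q) = (c • (q : C2), conjL (c • (q : C2))) := by
        rw [conjL_smul, ← Complex.inv_eq_conj hc1]
      rw [hmc] at hGan ⊢
      have h0 := hCR ⟨c • (q : C2), hmem⟩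
      rw [Lbar, dzbar_polarization hGan.differentiableAt hGfc,
        dzbar_polarization hGan.differentiableAt hGfc] at h0
      exact h0
  refine ⟨ε / 2, by positivity, by linarith [min_le_right δ 1],
    fun y => G (y, (hermSq y)⁻¹ • conjL y), ?_, ?_⟩
  · intro z hz
    rw [Metric.mem_ball] at hz
    have hz0 : z ≠ 0 := ne_zero_of_dist_lt_one (hz.trans_le (by linarith [min_le_right δ 1]))
    have hc : dist ((‖z‖ : ℝ) : ℂ) 1 < ε := by
      rw [← Complex.ofReal_one, Complex.dist_eq, ← Complex.ofReal_sub, Complex.norm_real,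
        Real.norm_eq_abs]
      exact (abs_norm_sub_one_le p z).trans_lt (by linarith)
    have hq : dist (toSphere z hz0 : C2) p < δ :=
      (dist_toSphere_le p hz0).trans_lt (by linarith [min_le_left δ 1])
    have hmz : m ((‖z‖ : ℝ), toSphere z hz0) = (z, (hermSq z)⁻¹ • conjL z) := by
      have hr : ((‖z‖ : ℝ) : ℂ) ≠ 0 := by exact_mod_cast norm_ne_zero_iff.2 hz0
      have e := norm_smul_toSphere hz0
      rw [hm]
      refine Prod.ext e ?_
      conv_rhs => rw [← e]
      simp only
      rw [hermSq_smul, conjL_smul, hermSq_S3, smul_smul, Complex.conj_ofReal]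
      congr 1
      field_simp
    have h1 := (hball' _ _ (hc.trans_le (min_le_left _ _)) hq).1.1
    have h2 := hK0 _ _ hc hq
    rw [hmz] at h1 h2
    exact (differentiableAt_reflected hz0 h1.differentiableAt h2).differentiableWithinAt
  · intro q hq
    have h := (hball' 1 q (by simpa using hδ)
      ((Metric.mem_ball.1 hq).trans_le (by linarith [min_le_left δ 1]))).2.self_of_nhds
    rw [one_smul, radialExt_coe] at h
    simp only
    rw [hermSq_S3, inv_one, one_smul, h]

theorem IsCR.extendsHolomorphically {f : S3 → ℂ} (hf : IsRealAnalytic f) (hCR : IsCR f) :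
    ExtendsHolomorphically f := by
  classical
  choose r hr hr1 h hd hh using hCR.exists_local_extension hf
  -- On halved balls the local extensions agree: if `z` lies in two of them, `z / |z|` lies in both
  -- original balls, and on the complex line of `z` both extensions equal `f` on the unit circle.
  have key : ∀ (p p' : S3) (z : C2), z ∈ Metric.ball (p : C2) (r p / 2) →
      z ∈ Metric.ball (p' : C2) (r p' / 2) → h p z = h p' z := by
    intro p p' z hz hz'
    rw [Metric.mem_ball] at hz hz'
    have hz0 : z ≠ 0 := ne_zero_of_dist_lt_one (hz.trans_le (by linarith [hr1 p, hr p]))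
    set q := toSphere z hz0
    set W := Metric.ball (p : C2) (r p) ∩ Metric.ball (p' : C2) (r p') with hW
    let s : ℂ →L[ℂ] C2 := (ContinuousLinearMap.id ℂ ℂ).smulRight (q : C2)
    have hs : ∀ c, s c = c • (q : C2) := fun c => rfl
    have hWo : IsOpen W := Metric.isOpen_ball.inter Metric.isOpen_ball
    have hWc : Convex ℝ W := (convex_ball _ _).inter (convex_ball _ _)
    have hqW : (q : C2) ∈ W := by
      constructor <;> rw [Metric.mem_ball]
      · exact (dist_toSphere_le p hz0).trans_lt (by linarith)
      · exact (dist_toSphere_le p' hz0).trans_lt (by linarith)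
    have hUc : Convex ℝ (s ⁻¹' W) := hWc.linear_preimage ((s : ℂ →ₗ[ℂ] C2).restrictScalars ℝ)
    have e := eqOn_zero_of_unit_circle (k := fun c => h p (s c) - h p' (s c))
      (hWo.preimage s.continuous) hUc.isPreconnected (by simpa [hs] using hqW)
      (((hd p).comp s.differentiable.differentiableOn fun c hc => hc.1).sub
        ((hd p').comp s.differentiable.differentiableOn fun c hc => hc.2))
      (fun c hc hc1 => by
        have hmem : c • (q : C2) ∈ Metric.sphere (0 : C2) 1 := by
          rw [mem_sphere_zero_iff_norm, norm_smul, hc1, one_mul, mem_sphere_zero_iff_norm.1 q.2]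
        have e1 := hh p ⟨_, hmem⟩ hc.1
        have e2 := hh p' ⟨_, hmem⟩ hc.2
        rw [hs, sub_eq_zero]
        exact e1.trans e2.symm)
    have hz1 : s ((‖z‖ : ℝ) : ℂ) = z := norm_smul_toSphere hz0
    have h3 := e (x := ((‖z‖ : ℝ) : ℂ)) (by
      rw [Set.mem_preimage, hz1]
      exact ⟨Metric.mem_ball.2 (by linarith [hr p]), Metric.mem_ball.2 (by linarith [hr p'])⟩)
    simp only [hz1, Pi.zero_apply, sub_eq_zero] at h3
    exact h3
  let H : C2 → ℂ := fun z =>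
    if hz : ∃ p : S3, z ∈ Metric.ball (p : C2) (r p / 2) then h hz.choose z else 0
  have hH : ∀ (p : S3) (z : C2), z ∈ Metric.ball (p : C2) (r p / 2) → H z = h p z := by
    intro p z hz
    have hex : ∃ p : S3, z ∈ Metric.ball (p : C2) (r p / 2) := ⟨p, hz⟩
    simp only [H, dif_pos hex]
    exact key _ _ z hex.choose_spec hz
  refine ⟨H, ⟨⋃ p : S3, Metric.ball (p : C2) (r p / 2),
    isOpen_iUnion fun p => Metric.isOpen_ball, ?_, ?_⟩, ?_⟩
  · intro z hz
    exact Set.mem_iUnion.2 ⟨⟨z, hz⟩, Metric.mem_ball_self (half_pos (hr _))⟩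
  · intro z hz
    obtain ⟨p, hp⟩ := Set.mem_iUnion.1 hz
    have hd' : DifferentiableAt ℂ (h p) z := (hd p).differentiableAt
      (Metric.isOpen_ball.mem_nhds (Metric.ball_subset_ball (by linarith [hr p]) hp))
    refine (hd'.congr_of_eventuallyEq ?_).differentiableWithinAt
    filter_upwards [Metric.isOpen_ball.mem_nhds hp] with y hy using hH p y hy
  · intro p
    rw [hH p p (Metric.mem_ball_self (half_pos (hr p)))]
    exact hh p p (Metric.mem_ball_self (hr p))

/-! ### CR functions from holomorphic functions, and the divergence -/

theorem inner_v₁ (z : C2) : inner ℝ z (v₁ z) = 0 := by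
  simp [PiLp.inner_apply, Complex.inner, v₁_zero, v₁_one]
  ring

theorem inner_I_smul_v₁ (z : C2) : inner ℝ z (Complex.I • v₁ z) = 0 := by
  simp [PiLp.inner_apply, Complex.inner, v₁_zero, v₁_one]
  ring

/-- At a point of the sphere, the derivative of `1 / |z|` vanishes on tangent vectors. -/
theorem exists_hasFDerivAt_inv_norm (p : S3) :
    ∃ L : C2 →L[ℝ] ℝ, HasFDerivAt (fun z : C2 => ‖z‖⁻¹) L p ∧
      ∀ v, inner ℝ (p : C2) v = 0 → L v = 0 := by
  have hp : ‖(p : C2)‖ = 1 := mem_sphere_zero_iff_norm.1 p.2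
  have h1 := (hasStrictFDerivAt_norm_sq (p : C2)).hasFDerivAt.sqrt (by rw [hp]; norm_num)
  simp only [Real.sqrt_sq (norm_nonneg _)] at h1
  refine ⟨_, (hasDerivAt_inv (by rw [hp]; norm_num)).comp_hasFDerivAt (p : C2) h1, fun v hv => ?_⟩
  simp [hv]

theorem toSphere_apply {z : C2} (hz : z ≠ 0) : (toSphere z hz : C2) = ‖z‖⁻¹ • z := rfl

theorem ExtendsHolomorphically.isCR {f : S3 → ℂ} (hf : ExtendsHolomorphically f) : IsCR f := by
  obtain ⟨h, ⟨U, hU, hSU, hd⟩, hh⟩ := hf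
  intro p
  have hp : ‖(p : C2)‖ = 1 := mem_sphere_zero_iff_norm.1 p.2
  have hp0 : (p : C2) ≠ 0 := ne_zero_of_mem_unit_sphere p
  have hhp : DifferentiableAt ℂ h p := hd.differentiableAt (hU.mem_nhds (hSU p.2))
  obtain ⟨L, hL, hL0⟩ := exists_hasFDerivAt_inv_norm p
  have hnp : ‖(p : C2)‖⁻¹ • (p : C2) = p := by rw [hp, inv_one, one_smul]
  have hν : HasFDerivAt (fun z : C2 => ‖z‖⁻¹ • z) _ (p : C2) := hL.smul (hasFDerivAt_id (p : C2))
  have h1 : HasFDerivAt (fun z : C2 => h (‖z‖⁻¹ • z)) _ (p : C2) :=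
    HasFDerivAt.comp (𝕜 := ℝ) (p : C2)
      (by rw [hnp]; exact hhp.hasFDerivAt.restrictScalars ℝ) hν
  have h2 : HasFDerivAt (radialExt f) _ (p : C2) := h1.congr_of_eventuallyEq (by
    filter_upwards [isOpen_ne.mem_nhds hp0] with z hz
    rw [radialExt, dif_neg hz, ← hh, toSphere_apply])
  have h3 : ∀ v, inner ℝ (p : C2) v = 0 → fderiv ℝ (radialExt f) p v = fderiv ℂ h p v := by
    intro v hv
    rw [h2.fderiv]
    simp [hL0 v hv, hp]
  have h4 := Lbar_eq f p
  rw [h3 _ (inner_v₁ _), h3 _ (inner_I_smul_v₁ _), map_smul, smul_eq_mul] at h4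
  linear_combination h4 / 2 + fderiv ℂ h p (v₁ p) / 2 * Complex.I_sq

/-- The divergence of `c conj f • v₁`, for a constant `c`. The cases `c = 1` and `c = i` are those
of a Legendrian field and of its image under `J`. -/
theorem divS3_eq {f : S3 → ℂ} (hf : IsRealAnalytic f) {X : S3 → C2} {c : ℂ}
    (hX : ∀ p : S3, X p = (c * conj (f p)) • v₁ p) (p : S3) :
    divS3 X p = (c * conj (2 * Lbar f p)).re := by
  have hp : ‖(p : C2)‖ = 1 := mem_sphere_zero_iff_norm.1 p.2
  have hp0 : (p : C2) ≠ 0 := ne_zero_of_mem_unit_sphere p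
  obtain ⟨L, hL, hL0⟩ := exists_hasFDerivAt_inv_norm p
  have hfd := (analyticAt_radialExt hf hp0).differentiableAt.hasFDerivAt
  have hcf : HasFDerivAt (fun z => c * conj (radialExt f z))
      (c • (Complex.conjCLE : ℂ →L[ℝ] ℂ).comp (fderiv ℝ (radialExt f) p)) (p : C2) :=
    ((Complex.conjCLE : ℂ →L[ℝ] ℂ).hasFDerivAt.comp (p : C2) hfd).const_mul c
  have hφ : HasFDerivAt (fun z => ‖z‖⁻¹ • (c * conj (radialExt f z))) _ (p : C2) := hL.smul hcf
  set φ : C2 → ℂ := fun z => ‖z‖⁻¹ • (c * conj (radialExt f z))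
  have hφd : ∀ v, inner ℝ (p : C2) v = 0 →
      fderiv ℝ φ p v = c * conj (fderiv ℝ (radialExt f) p v) := by
    intro v hv
    rw [hφ.fderiv]
    simp [hL0 v hv, hp]
  have hXφ : HasFDerivAt (radialExt X) (φ p • v₁L + (fderiv ℝ φ p).smulRight (v₁ p)) (p : C2) := by
    have h := hφ.differentiableAt.hasFDerivAt.smul (v₁L.hasFDerivAt (x := (p : C2)))
    refine h.congr_of_eventuallyEq ?_
    filter_upwards [isOpen_ne.mem_nhds hp0] with z hz
    have hv : v₁ (toSphere z hz) = ‖z‖⁻¹ • v₁ z := v₁L.map_smul ‖z‖⁻¹ z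
    rw [radialExt, dif_neg hz, hX, hv]
    simp only [Pi.smul_apply', φ, v₁L_apply, radialExt, dif_neg hz]
    rw [smul_comm, smul_assoc]
  rw [divS3, hXφ.fderiv, Lbar_eq, trace_C2]
  have e1 := hφd _ (inner_v₁ p)
  have e2 := hφd _ (inner_I_smul_v₁ p)
  have e3 : (c * conj (fderiv ℝ (radialExt f) p (v₁ p)
      + Complex.I * fderiv ℝ (radialExt f) p (Complex.I • v₁ p))).re
      = (fderiv ℝ φ p (v₁ p)).re + (fderiv ℝ φ p (Complex.I • v₁ p)).im := by
    rw [e1, e2]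
    simp
    ring
  rw [e3, realLinear_apply _ (v₁ p), realLinear_apply _ (Complex.I • v₁ p)]
  simp [v₁_zero, v₁_one]
  ring

theorem isCR_iff_divS3 {f : S3 → ℂ} (hf : IsRealAnalytic f) {X : S3 → C2} (hX : IsRePart f X) :
    IsCR f ↔ (∀ p, divS3 X p = 0) ∧ ∀ p, divS3 (J X) p = 0 := by
  have h1 : ∀ p, divS3 X p = 2 * (Lbar f p).re := fun p => by
    rw [divS3_eq hf (c := 1) (by simpa using isRePart_iff.1 hX)]
    simp
  have h2 : ∀ p, divS3 (J X) p = 2 * (Lbar f p).im := fun p => by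
    rw [divS3_eq hf (isImPart_iff.1 hX.isImPart_J)]
    simp
  simp only [h1, h2, IsCR, Complex.ext_iff, Complex.zero_re, Complex.zero_im, mul_eq_zero,
    two_ne_zero, false_or, forall_and]

/-! ### The Bateman variables and their differentials -/

/-- `f` is differentiable at the space-time point `q` and its differential there is the function
`f'` on `ℝ × ℝ³`. It keeps differentials as explicit formulas, without naming the continuous linear
maps. -/
def HasDifferential (f : ℝ × R3 → ℂ) (f' : ℝ × R3 → ℂ) (q : ℝ × R3) : Prop :=
  ∃ L : ℝ × R3 →L[ℝ] ℂ, HasFDerivAt f L q ∧ ∀ v, L v = f' v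

namespace HasDifferential

variable {f g f' g' : ℝ × R3 → ℂ} {q : ℝ × R3}

theorem const (c : ℂ) (q : ℝ × R3) : HasDifferential (fun _ => c) (fun _ => 0) q :=
  ⟨0, hasFDerivAt_const c q, fun _ => rfl⟩

theorem time (q : ℝ × R3) : HasDifferential (fun q => (q.1 : ℂ)) (fun v => (v.1 : ℂ)) q :=
  ⟨_, (Complex.ofRealCLM.comp (ContinuousLinearMap.fst ℝ ℝ R3)).hasFDerivAt, fun _ => rfl⟩

theorem coord (i : Fin 3) (q : ℝ × R3) :
    HasDifferential (fun q => (q.2 i : ℂ)) (fun v => (v.2 i : ℂ)) q :=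
  ⟨_, (Complex.ofRealCLM.comp ((EuclideanSpace.proj (𝕜 := ℝ) (ι := Fin 3) i : R3 →L[ℝ] ℝ).comp
    (ContinuousLinearMap.snd ℝ ℝ R3))).hasFDerivAt, fun _ => rfl⟩

theorem add (hf : HasDifferential f f' q) (hg : HasDifferential g g' q) :
    HasDifferential (fun q => f q + g q) (fun v => f' v + g' v) q := by
  obtain ⟨L, hL, hv⟩ := hf
  obtain ⟨L', hL', hv'⟩ := hg
  exact ⟨_, hL.add hL', fun v => by simp [hv, hv']⟩

theorem sub (hf : HasDifferential f f' q) (hg : HasDifferential g g' q) :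
    HasDifferential (fun q => f q - g q) (fun v => f' v - g' v) q := by
  obtain ⟨L, hL, hv⟩ := hf
  obtain ⟨L', hL', hv'⟩ := hg
  exact ⟨_, hL.sub hL', fun v => by simp [hv, hv']⟩

theorem mul (hf : HasDifferential f f' q) (hg : HasDifferential g g' q) :
    HasDifferential (fun q => f q * g q) (fun v => f q * g' v + g q * f' v) q := by
  obtain ⟨L, hL, hv⟩ := hf
  obtain ⟨L', hL', hv'⟩ := hg
  exact ⟨_, hL.mul hL', fun v => by simp [hv, hv']⟩

theorem inv (hf : HasDifferential f f' q) (h0 : f q ≠ 0) :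
    HasDifferential (fun q => (f q)⁻¹) (fun v => -(f q)⁻¹ ^ 2 * f' v) q := by
  obtain ⟨L, hL, hv⟩ := hf
  refine ⟨_, ((hasFDerivAt_inv h0).restrictScalars ℝ).comp q hL, fun v => ?_⟩
  simp [hv]
  ring

theorem congr (hf : HasDifferential f f' q) (h : ∀ q, g q = f q) (h' : ∀ v, g' v = f' v) :
    HasDifferential g g' q := by
  rwa [funext h, funext h']

theorem fderiv_space {t : ℝ} {x : R3} (hf : HasDifferential f f' (t, x)) (v : R3) :
    fderiv ℝ (fun y => f (t, y)) x v = f' (0, v) := by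
  obtain ⟨L, hL, hv⟩ := hf
  have h : HasFDerivAt (fun y => f (t, y)) (L.comp (ContinuousLinearMap.inr ℝ ℝ R3)) x :=
    hL.comp x (hasFDerivAt_prodMk_right t x)
  rw [h.fderiv, ← hv]
  rfl

theorem differentiableAt_space {t : ℝ} {x : R3} (hf : HasDifferential f f' (t, x)) :
    DifferentiableAt ℝ (fun y => f (t, y)) x := by
  obtain ⟨L, hL, hv⟩ := hf
  exact (hL.comp x (hasFDerivAt_prodMk_right t x)).differentiableAt

theorem hasDerivAt_time {t : ℝ} {x : R3} (hf : HasDifferential f f' (t, x)) :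
    HasDerivAt (fun s => f (s, x)) (f' (1, 0)) t := by
  obtain ⟨L, hL, hv⟩ := hf
  have h : HasFDerivAt (fun s => f (s, x)) (L.comp (ContinuousLinearMap.inl ℝ ℝ R3)) t :=
    hL.comp t (hasFDerivAt_prodMk_left t x)
  have h' := h.hasDerivAt
  simpa [hv] using h'

end HasDifferential

theorem den_ne_zero (t : ℝ) (x : R3) : den t x ≠ 0 :=
  Complex.normSq_pos.1 (normSq_den_pos t x)

/-- `e = 1 / d`, the inverse of the common denominator of the Bateman variables. -/
def invDen (q : ℝ × R3) : ℂ := (den q.1 q.2)⁻¹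

theorem invDen_mul (t : ℝ) (x : R3) : invDen (t, x) * ((x 0 : ℂ) ^ 2 + (x 1 : ℂ) ^ 2 + (x 2 : ℂ) ^ 2
    - ((t : ℂ) - Complex.I) ^ 2) = 1 :=
  inv_mul_cancel₀ (den_ne_zero t x)

/-- `a = z - t + i`, so that `α = 1 + 2 i a / d`. -/
def numA (q : ℝ × R3) : ℂ := (q.2 2 : ℂ) - (q.1 : ℂ) + Complex.I

/-- `b = x - i y`, so that `β = 2 b / d`. -/
def numB (q : ℝ × R3) : ℂ := (q.2 0 : ℂ) - Complex.I * (q.2 1 : ℂ)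

theorem alpha_eq (q : ℝ × R3) : alpha q.1 q.2 = 1 + 2 * Complex.I * (numA q * invDen q) := by
  have h := den_ne_zero q.1 q.2
  rw [alpha, invDen, numA]
  field_simp
  rw [den]
  linear_combination -Complex.I_sq

theorem beta_eq (q : ℝ × R3) : beta q.1 q.2 = 2 * (numB q * invDen q) := by
  rw [beta, invDen, numB]
  ring

/-- The differential at `q` of `1 / d`. -/
def dInvDen (q v : ℝ × R3) : ℂ := -invDen q ^ 2 * (2 * ((q.2 0 : ℂ) * (v.2 0 : ℂ)
  + (q.2 1 : ℂ) * (v.2 1 : ℂ) + (q.2 2 : ℂ) * (v.2 2 : ℂ)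
  - ((q.1 : ℂ) - Complex.I) * (v.1 : ℂ)))

open HasDifferential in
theorem hasDifferential_invDen (q : ℝ × R3) : HasDifferential invDen (dInvDen q) q := by
  have hτ := (time q).sub (const Complex.I q)
  have h := ((((coord 0 q).mul (coord 0 q)).add ((coord 1 q).mul (coord 1 q))).add
    ((coord 2 q).mul (coord 2 q))).sub (hτ.mul hτ)
  have h' : HasDifferential (fun q => den q.1 q.2) _ q :=
    h.congr (fun q => by rw [den]; ring) fun v => rfl
  exact (h'.inv (den_ne_zero q.1 q.2)).congr (fun _ => rfl) fun v => by
    rw [dInvDen, invDen]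
    ring

open HasDifferential in
theorem hasDifferential_numA (q : ℝ × R3) :
    HasDifferential numA (fun v => (v.2 2 : ℂ) - (v.1 : ℂ)) q :=
  (((coord 2 q).sub (time q)).add (const Complex.I q)).congr (fun _ => rfl) fun v => by simp

open HasDifferential in
theorem hasDifferential_numB (q : ℝ × R3) :
    HasDifferential numB (fun v => (v.2 0 : ℂ) - Complex.I * (v.2 1 : ℂ)) q :=
  ((coord 0 q).sub ((const Complex.I q).mul (coord 1 q))).congr (fun _ => rfl) fun v => by simp

/-- The differential at `q` of `α`. -/
def dAlpha (q v : ℝ × R3) : ℂ :=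
  2 * Complex.I * (((v.2 2 : ℂ) - (v.1 : ℂ)) * invDen q + numA q * dInvDen q v)

/-- The differential at `q` of `β`. -/
def dBeta (q v : ℝ × R3) : ℂ :=
  2 * (((v.2 0 : ℂ) - Complex.I * (v.2 1 : ℂ)) * invDen q + numB q * dInvDen q v)

open HasDifferential in
theorem hasDifferential_alpha (q : ℝ × R3) :
    HasDifferential (fun q => alpha q.1 q.2) (dAlpha q) q :=
  ((const 1 q).add ((const (2 * Complex.I) q).mul
    ((hasDifferential_numA q).mul (hasDifferential_invDen q)))).congr alpha_eq fun v => by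
      rw [dAlpha]
      ring

open HasDifferential in
theorem hasDifferential_beta (q : ℝ × R3) :
    HasDifferential (fun q => beta q.1 q.2) (dBeta q) q :=
  ((const 2 q).mul ((hasDifferential_numB q).mul (hasDifferential_invDen q))).congr beta_eq
    fun v => by
      rw [dBeta]
      ring

/-- The null vector `(a² - b², -i (a² + b²), -2 a b)`, to which `∇α × ∇β` is proportional. -/
def nullVec (q : ℝ × R3) : Fin 3 → ℂ :=
  ![numA q ^ 2 - numB q ^ 2, -Complex.I * (numA q ^ 2 + numB q ^ 2), -2 * numA q * numB q]

theorem grad_alpha (t : ℝ) (x : R3) (i : Fin 3) :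
    grad (alpha t) x i = dAlpha (t, x) (0, EuclideanSpace.single i 1) :=
  (hasDifferential_alpha (t, x)).fderiv_space _

theorem grad_beta (t : ℝ) (x : R3) (i : Fin 3) :
    grad (beta t) x i = dBeta (t, x) (0, EuclideanSpace.single i 1) :=
  (hasDifferential_beta (t, x)).fderiv_space _

theorem grad_cross_grad (t : ℝ) (x : R3) :
    grad (alpha t) x ⨯₃ grad (beta t) x = (4 * invDen (t, x) ^ 3) • nullVec (t, x) := by
  have hI := Complex.I_sq
  have he := invDen_mul t x
  ext k
  rw [cross_apply]
  fin_cases k <;>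
  · simp [grad_alpha, grad_beta, dAlpha, dBeta, dInvDen, nullVec, numA, numB]
    generalize invDen (t, x) = e at *
    generalize ((x 0 : ℝ) : ℂ) = x0 at *
    generalize ((x 1 : ℝ) : ℂ) = x1 at *
    generalize ((x 2 : ℝ) : ℂ) = x2 at *
    generalize (t : ℂ) = t at *
    generalize Complex.I = I at *
    grind

/-! ### The differential of the Bateman field -/

theorem batemanField_apply (h : C2 → ℂ) (t : ℝ) (x : R3) (k : Fin 3) :
    batemanField h t x k = h (hopfMap t x) * (4 * invDen (t, x) ^ 3 * nullVec (t, x) k) := by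
  rw [batemanField, grad_cross_grad]
  rfl

theorem hopfMap_eq (t : ℝ) (x : R3) :
    hopfMap t x = alpha t x • EuclideanSpace.single 0 (1 : ℂ)
      + beta t x • EuclideanSpace.single 1 (1 : ℂ) := by
  ext j
  fin_cases j <;> simp [hopfMap]

theorem hasDifferential_comp_hopfMap {h : C2 → ℂ} {q : ℝ × R3}
    (hd : DifferentiableAt ℂ h (hopfMap q.1 q.2)) :
    HasDifferential (fun q => h (hopfMap q.1 q.2)) (fun v =>
      fderiv ℂ h (hopfMap q.1 q.2) (EuclideanSpace.single 0 1) * dAlpha q v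
      + fderiv ℂ h (hopfMap q.1 q.2) (EuclideanSpace.single 1 1) * dBeta q v) q := by
  obtain ⟨L, hL, hLv⟩ := hasDifferential_alpha q
  obtain ⟨M, hM, hMv⟩ := hasDifferential_beta q
  have hhopf : HasFDerivAt (fun q : ℝ × R3 => hopfMap q.1 q.2)
      (L.smulRight (EuclideanSpace.single 0 (1 : ℂ) : C2)
        + M.smulRight (EuclideanSpace.single 1 (1 : ℂ) : C2)) q := by
    exact ((hL.smul_const (EuclideanSpace.single 0 (1 : ℂ) : C2)).add
      (hM.smul_const (EuclideanSpace.single 1 (1 : ℂ) : C2))).congr_of_eventuallyEq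
      (Eventually.of_forall fun q => hopfMap_eq q.1 q.2)
  refine ⟨_, (hd.hasFDerivAt.restrictScalars ℝ).comp q hhopf, fun v => ?_⟩
  simp [hLv, hMv]
  ring

/-- The differential at `q` of the null vector. -/
def dNullVec (q v : ℝ × R3) : Fin 3 → ℂ :=
  ![2 * numA q * ((v.2 2 : ℂ) - (v.1 : ℂ)) - 2 * numB q * ((v.2 0 : ℂ) - Complex.I * (v.2 1 : ℂ)),
    -Complex.I * (2 * numA q * ((v.2 2 : ℂ) - (v.1 : ℂ))
      + 2 * numB q * ((v.2 0 : ℂ) - Complex.I * (v.2 1 : ℂ))),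
    -2 * (((v.2 2 : ℂ) - (v.1 : ℂ)) * numB q
      + numA q * ((v.2 0 : ℂ) - Complex.I * (v.2 1 : ℂ)))]

open HasDifferential in
theorem hasDifferential_nullVec (q : ℝ × R3) (k : Fin 3) :
    HasDifferential (fun q => nullVec q k) (fun v => dNullVec q v k) q := by
  have ha := hasDifferential_numA q
  have hb := hasDifferential_numB q
  fin_cases k
  · refine ((ha.mul ha).sub (hb.mul hb)).congr (fun q => ?_) fun v => ?_
    · simp [nullVec]
      ring
    · simp [dNullVec]
      ring
  · refine ((const (-Complex.I) q).mul ((ha.mul ha).add (hb.mul hb))).congr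
      (fun q => ?_) fun v => ?_
    · simp [nullVec]
      ring
    · simp [dNullVec]
      ring
  · refine ((const (-2) q).mul (ha.mul hb)).congr (fun q => ?_) fun v => ?_
    · simp [nullVec]
      ring
    · simp [dNullVec]
      ring

/-- The differential at `q` of the component `k` of the Bateman field. -/
def dField (h : C2 → ℂ) (q : ℝ × R3) (k : Fin 3) (v : ℝ × R3) : ℂ :=
  (fderiv ℂ h (hopfMap q.1 q.2) (EuclideanSpace.single 0 1) * dAlpha q v
      + fderiv ℂ h (hopfMap q.1 q.2) (EuclideanSpace.single 1 1) * dBeta q v)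
    * (4 * invDen q ^ 3 * nullVec q k)
  + h (hopfMap q.1 q.2) * (4 * (3 * invDen q ^ 2 * dInvDen q v * nullVec q k
      + invDen q ^ 3 * dNullVec q v k))

open HasDifferential in
theorem hasDifferential_batemanField {h : C2 → ℂ} (hd : ∀ p : S3, DifferentiableAt ℂ h p)
    (q : ℝ × R3) (k : Fin 3) :
    HasDifferential (fun q => batemanField h q.1 q.2 k) (dField h q k) q := by
  have hh := hasDifferential_comp_hopfMap (hd (hopfMapS3 q.1 q.2))
  have he := hasDifferential_invDen q
  refine (hh.mul (((const 4 q).mul ((he.mul he).mul he)).mul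
    (hasDifferential_nullVec q k))).congr (fun q => ?_) fun v => ?_
  · rw [batemanField_apply]
    ring
  · rw [dField]
    ring

/-- The Bateman field is divergence-free. -/
theorem dField_div (h : C2 → ℂ) (t : ℝ) (x : R3) :
    ∑ k, dField h (t, x) k (0, EuclideanSpace.single k 1) = 0 := by
  have hI := Complex.I_sq
  have he := invDen_mul t x
  simp [Fin.sum_univ_three, dField, dAlpha, dBeta, dInvDen, nullVec, dNullVec, numA, numB]
  generalize invDen (t, x) = e at *
  generalize h (hopfMap t x) = H
  generalize fderiv ℂ h (hopfMap t x) (EuclideanSpace.single 0 1) = H0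
  generalize fderiv ℂ h (hopfMap t x) (EuclideanSpace.single 1 1) = H1
  generalize ((x 0 : ℝ) : ℂ) = x0 at *
  generalize ((x 1 : ℝ) : ℂ) = x1 at *
  generalize ((x 2 : ℝ) : ℂ) = x2 at *
  generalize (t : ℂ) = t at *
  generalize Complex.I = I at *
  grind

/-- The equation `curl F = i ∂F/∂t`, in the component `i` of each cyclic triple `(i, j, k)`. Its
real and imaginary parts are the two dynamical Maxwell equations. -/
theorem dField_curl (h : C2 → ℂ) (t : ℝ) (x : R3) {i j k : Fin 3}
    (hijk : (i, j, k) = (0, 1, 2) ∨ (i, j, k) = (1, 2, 0) ∨ (i, j, k) = (2, 0, 1)) :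
    dField h (t, x) k (0, EuclideanSpace.single j 1)
      - dField h (t, x) j (0, EuclideanSpace.single k 1)
      = Complex.I * dField h (t, x) i (1, 0) := by
  have hI := Complex.I_sq
  have he := invDen_mul t x
  rcases hijk with h | h | h <;>
  · obtain ⟨rfl, rfl, rfl⟩ := by simpa using h
    clear h
    simp [dField, dAlpha, dBeta, dInvDen, nullVec, dNullVec, numA, numB]
    generalize invDen (t, x) = e at *
    generalize h (hopfMap t x) = H
    generalize fderiv ℂ h (hopfMap t x) (EuclideanSpace.single 0 1) = H0
    generalize fderiv ℂ h (hopfMap t x) (EuclideanSpace.single 1 1) = H1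
    generalize ((x 0 : ℝ) : ℂ) = x0 at *
    generalize ((x 1 : ℝ) : ℂ) = x1 at *
    generalize ((x 2 : ℝ) : ℂ) = x2 at *
    generalize (t : ℂ) = t at *
    generalize Complex.I = I at *
    grind

/-! ### Maxwell equations, nullity and pushforward -/

theorem HasDifferential.pd_re {f f' : ℝ × R3 → ℂ} {t : ℝ} {x : R3}
    (hf : HasDifferential f f' (t, x)) (i : Fin 3) :
    pd i (fun y => (f (t, y)).re) x = (f' (0, EuclideanSpace.single i 1)).re := by
  have h : HasFDerivAt (fun y => (f (t, y)).re) _ x :=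
    Complex.reCLM.hasFDerivAt.comp x hf.differentiableAt_space.hasFDerivAt
  rw [pd, h.fderiv, ← hf.fderiv_space]
  rfl

theorem HasDifferential.pd_im {f f' : ℝ × R3 → ℂ} {t : ℝ} {x : R3}
    (hf : HasDifferential f f' (t, x)) (i : Fin 3) :
    pd i (fun y => (f (t, y)).im) x = (f' (0, EuclideanSpace.single i 1)).im := by
  have h : HasFDerivAt (fun y => (f (t, y)).im) _ x :=
    Complex.imCLM.hasFDerivAt.comp x hf.differentiableAt_space.hasFDerivAt
  rw [pd, h.fderiv, ← hf.fderiv_space]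
  rfl

theorem contDiff_coord (j : Fin 3) : ContDiff ℝ ∞ fun q : ℝ × R3 => (q.2 j : ℂ) :=
  (Complex.ofRealCLM.comp ((EuclideanSpace.proj (𝕜 := ℝ) (ι := Fin 3) j : R3 →L[ℝ] ℝ).comp
    (ContinuousLinearMap.snd ℝ ℝ R3))).contDiff

theorem contDiff_time : ContDiff ℝ ∞ fun q : ℝ × R3 => (q.1 : ℂ) :=
  (Complex.ofRealCLM.comp (ContinuousLinearMap.fst ℝ ℝ R3)).contDiff

theorem contDiff_invDen : ContDiff ℝ ∞ invDen := by
  refine ContDiff.inv (f := fun q : ℝ × R3 => den q.1 q.2) ?_ fun q => den_ne_zero q.1 q.2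
  exact ((((contDiff_coord 0).pow 2).add ((contDiff_coord 1).pow 2)).add
    ((contDiff_coord 2).pow 2)).sub ((contDiff_time.sub contDiff_const).pow 2)

theorem contDiff_numA : ContDiff ℝ ∞ numA :=
  ((contDiff_coord 2).sub contDiff_time).add contDiff_const

theorem contDiff_numB : ContDiff ℝ ∞ numB :=
  (contDiff_coord 0).sub (contDiff_const.mul (contDiff_coord 1))

theorem contDiff_nullVec (k : Fin 3) : ContDiff ℝ ∞ fun q => nullVec q k := by
  have ha := contDiff_numA
  have hb := contDiff_numB
  fin_cases k
  · exact (ha.pow 2).sub (hb.pow 2)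
  · exact contDiff_const.mul ((ha.pow 2).add (hb.pow 2))
  · exact (contDiff_const.mul ha).mul hb

theorem contDiff_hopfMap : ContDiff ℝ ∞ fun q : ℝ × R3 => hopfMap q.1 q.2 := by
  have hα : ContDiff ℝ ∞ fun q : ℝ × R3 => alpha q.1 q.2 := by
    simp only [alpha_eq]
    exact contDiff_const.add (contDiff_const.mul (contDiff_numA.mul contDiff_invDen))
  have hβ : ContDiff ℝ ∞ fun q : ℝ × R3 => beta q.1 q.2 := by
    simp only [beta_eq]
    exact contDiff_const.mul (contDiff_numB.mul contDiff_invDen)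
  simp only [hopfMap_eq]
  exact (hα.smul contDiff_const).add (hβ.smul contDiff_const)

theorem contDiff_batemanField {h : C2 → ℂ} (ha : IsRealAnalytic fun p : S3 => h p) (k : Fin 3) :
    ContDiff ℝ ∞ fun q : ℝ × R3 => batemanField h q.1 q.2 k := by
  have hh : ContDiff ℝ ∞ fun q : ℝ × R3 => radialExt (fun p : S3 => h p) (hopfMap q.1 q.2) := by
    refine contDiff_iff_contDiffAt.2 fun q => ContDiffAt.comp (g := radialExt _) q ?_
      contDiff_hopfMap.contDiffAt
    exact (analyticAt_radialExt ha (ne_zero_of_mem_unit_sphere (hopfMapS3 q.1 q.2))).contDiffAt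
  have he : ∀ q : ℝ × R3, batemanField h q.1 q.2 k =
      radialExt (fun p : S3 => h p) (hopfMap q.1 q.2) * (4 * invDen q ^ 3 * nullVec q k) := by
    intro q
    rw [batemanField_apply]
    exact congrArg (· * _) (radialExt_coe (fun p : S3 => h p) (hopfMapS3 q.1 q.2)).symm
  simp only [he]
  exact hh.mul ((contDiff_const.mul (contDiff_invDen.pow 3)).mul (contDiff_nullVec k))

theorem isMaxwell_batemanField {h : C2 → ℂ} (hd : ∀ p : S3, DifferentiableAt ℂ h p)
    (ha : IsRealAnalytic fun p : S3 => h p) :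
    IsMaxwell (electric (batemanField h)) (magnetic (batemanField h)) where
  smooth_E := contDiff_euclidean.2 fun k => Complex.reCLM.contDiff.comp (contDiff_batemanField ha k)
  smooth_B := contDiff_euclidean.2 fun k => Complex.imCLM.contDiff.comp (contDiff_batemanField ha k)
  dt_E t x := by
    have hF := hasDifferential_batemanField hd (t, x)
    have h1 : HasDerivAt (fun s => electric (batemanField h) s x)
        (WithLp.toLp 2 fun k => (dField h (t, x) k (1, 0)).re) t :=
      (EuclideanSpace.equiv (Fin 3) ℝ).symm.hasFDerivAt.comp_hasDerivAt t (hasDerivAt_pi.2 fun k =>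
        Complex.reCLM.hasFDerivAt.comp_hasDerivAt t (hF k).hasDerivAt_time)
    have hc : ∀ i j k : Fin 3, (i, j, k) = (0, 1, 2) ∨ (i, j, k) = (1, 2, 0) ∨
        (i, j, k) = (2, 0, 1) → (dField h (t, x) i (1, 0)).re =
        pd j (fun y => magnetic (batemanField h) t y k) x
          - pd k (fun y => magnetic (batemanField h) t y j) x := fun i j k hijk => by
      have h2 := congrArg Complex.im (dField_curl h t x hijk)
      rw [Complex.sub_im, Complex.I_mul_im] at h2
      rw [← h2]
      exact congrArg₂ (· - ·) ((hF k).pd_im j).symm ((hF j).pd_im k).symm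
    rw [h1.deriv]
    ext i
    fin_cases i
    · exact hc 0 1 2 (by simp)
    · exact hc 1 2 0 (by simp)
    · exact hc 2 0 1 (by simp)
  dt_B t x := by
    have hF := hasDifferential_batemanField hd (t, x)
    have h1 : HasDerivAt (fun s => magnetic (batemanField h) s x)
        (WithLp.toLp 2 fun k => (dField h (t, x) k (1, 0)).im) t :=
      (EuclideanSpace.equiv (Fin 3) ℝ).symm.hasFDerivAt.comp_hasDerivAt t (hasDerivAt_pi.2 fun k =>
        Complex.imCLM.hasFDerivAt.comp_hasDerivAt t (hF k).hasDerivAt_time)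
    have hc : ∀ i j k : Fin 3, (i, j, k) = (0, 1, 2) ∨ (i, j, k) = (1, 2, 0) ∨
        (i, j, k) = (2, 0, 1) → (dField h (t, x) i (1, 0)).im =
        -(pd j (fun y => electric (batemanField h) t y k) x
          - pd k (fun y => electric (batemanField h) t y j) x) := fun i j k hijk => by
      have h2 := congrArg Complex.re (dField_curl h t x hijk)
      rw [Complex.sub_re, Complex.I_mul_re] at h2
      rw [← neg_eq_iff_eq_neg, ← h2]
      exact congrArg₂ (· - ·) ((hF k).pd_re j).symm ((hF j).pd_re k).symm
    rw [h1.deriv]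
    ext i
    fin_cases i
    · exact hc 0 1 2 (by simp)
    · exact hc 1 2 0 (by simp)
    · exact hc 2 0 1 (by simp)
  div_E t x := by
    have h1 := congrArg Complex.re (dField_div h t x)
    rw [Complex.re_sum] at h1
    exact (Finset.sum_congr rfl fun k _ =>
      (hasDifferential_batemanField hd (t, x) k).pd_re k).trans h1
  div_B t x := by
    have h1 := congrArg Complex.im (dField_div h t x)
    rw [Complex.im_sum] at h1
    exact (Finset.sum_congr rfl fun k _ =>
      (hasDifferential_batemanField hd (t, x) k).pd_im k).trans h1

/-- The complex square `F · F = |E|² - |B|² + 2 i E · B` vanishes. -/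
theorem batemanField_sq (h : C2 → ℂ) (t : ℝ) (x : R3) : ∑ k, batemanField h t x k ^ 2 = 0 := by
  simp only [batemanField_apply, Fin.sum_univ_three, nullVec, Matrix.cons_val]
  linear_combination (h (hopfMap t x) * (4 * invDen (t, x) ^ 3)
    * (numA (t, x) ^ 2 + numB (t, x) ^ 2)) ^ 2 * Complex.I_sq

theorem isNull_batemanField (h : C2 → ℂ) :
    IsNull (electric (batemanField h)) (magnetic (batemanField h)) := by
  intro t x
  have h0 := batemanField_sq h t x
  have hre := congrArg Complex.re h0
  have him := congrArg Complex.im h0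
  simp only [Fin.sum_univ_three, pow_two, Complex.add_re, Complex.mul_re, Complex.add_im,
    Complex.mul_im, Complex.zero_re, Complex.zero_im] at hre him
  constructor
  · simp [PiLp.inner_apply, Fin.sum_univ_three, electric, magnetic]
    linarith
  · rw [← sq_eq_sq₀ (norm_nonneg _) (norm_nonneg _), EuclideanSpace.norm_sq_eq,
      EuclideanSpace.norm_sq_eq]
    simp [Fin.sum_univ_three, electric, magnetic]
    linarith

/-- The complex conjugate of `1 / d`. -/
def conjInvDen (q : ℝ × R3) : ℂ := conj (invDen q)

theorem conjInvDen_mul (t : ℝ) (x : R3) : conjInvDen (t, x) *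
    ((x 0 : ℂ) ^ 2 + (x 1 : ℂ) ^ 2 + (x 2 : ℂ) ^ 2 - ((t : ℂ) + Complex.I) ^ 2) = 1 := by
  have := congrArg conj (invDen_mul t x)
  simpa [conjInvDen] using this

theorem pushFactor_eq (t : ℝ) (x : R3) : (pushFactor t x : ℂ) =
    8 * (1 + (x 0 : ℂ) ^ 2 + (x 1 : ℂ) ^ 2 + ((x 2 : ℂ) - t) ^ 2)
      * (invDen (t, x) * conjInvDen (t, x)) ^ 2 := by
  have h : invDen (t, x) * conjInvDen (t, x) = ((Complex.normSq (den t x) : ℝ) : ℂ)⁻¹ := by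
    rw [conjInvDen, Complex.mul_conj, invDen, Complex.normSq_inv, Complex.ofReal_inv]
  rw [h, normSq_den, pushFactor]
  push_cast
  rw [div_eq_mul_inv, inv_pow]

theorem fderiv_hopfMap_apply (t : ℝ) (x v : R3) :
    fderiv ℝ (hopfMap t) x v = !₂[dAlpha (t, x) (0, v), dBeta (t, x) (0, v)] := by
  have hA := hasDifferential_alpha (t, x)
  have hB := hasDifferential_beta (t, x)
  have h : HasFDerivAt (hopfMap t) _ x :=
    ((hA.differentiableAt_space.hasFDerivAt.smul_const (EuclideanSpace.single 0 (1 : ℂ) : C2)).add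
      (hB.differentiableAt_space.hasFDerivAt.smul_const
        (EuclideanSpace.single 1 (1 : ℂ) : C2))).congr_of_eventuallyEq
      (Eventually.of_forall fun y => hopfMap_eq t y)
  have eA : fderiv ℝ (alpha t) x v = _ := hA.fderiv_space v
  have eB : fderiv ℝ (beta t) x v = _ := hB.fderiv_space v
  rw [h.fderiv]
  ext j
  fin_cases j <;> simp [eA, eB]

theorem conj_nullVec (q : ℝ × R3) : (fun k => conj (nullVec q k)) =
    ![conj (numA q) ^ 2 - conj (numB q) ^ 2, Complex.I * (conj (numA q) ^ 2 + conj (numB q) ^ 2),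
      -2 * conj (numA q) * conj (numB q)] := by
  ext k
  fin_cases k <;> simp [nullVec, map_ofNat]

theorem conj_numA (q : ℝ × R3) : conj (numA q) = (q.2 2 : ℂ) - (q.1 : ℂ) - Complex.I := by
  simp [numA, sub_eq_add_neg]

theorem conj_numB (q : ℝ × R3) : conj (numB q) = (q.2 0 : ℂ) + Complex.I * (q.2 1 : ℂ) := by
  simp [numB]

/-- The pushforward of `Re (c ∇α × ∇β)`. The field `∇α × ∇β` itself is annihilated by `dα` and
`dβ`, so that only its conjugate contributes. -/
theorem fderiv_hopfMap_re (t : ℝ) (x : R3) (c : ℂ) :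
    fderiv ℝ (hopfMap t) x
      (WithLp.toLp 2 fun k => (c * (4 * invDen (t, x) ^ 3 * nullVec (t, x) k)).re)
      = pushFactor t x • conj c • v₁ (hopfMap t x) := by
  have hI := Complex.I_sq
  have he := invDen_mul t x
  have he' := conjInvDen_mul t x
  have hα : conj (alpha t x) = 1 - 2 * Complex.I * (conj (numA (t, x)) * conjInvDen (t, x)) := by
    rw [alpha_eq (t, x)]
    simp [conjInvDen, map_ofNat, sub_eq_add_neg]
  have hβ : conj (beta t x) = 2 * (conj (numB (t, x)) * conjInvDen (t, x)) := by
    rw [beta_eq (t, x)]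
    simp [conjInvDen, map_ofNat]
  have hre : ∀ k, (((c * (4 * invDen (t, x) ^ 3 * nullVec (t, x) k)).re : ℝ) : ℂ) =
      (c * (4 * invDen (t, x) ^ 3 * nullVec (t, x) k)
        + conj c * (4 * conjInvDen (t, x) ^ 3 * conj (nullVec (t, x) k))) / 2 := fun k => by
    rw [Complex.re_eq_add_conj]
    simp [conjInvDen, map_ofNat]
  have hc : ∀ k, conj (nullVec (t, x) k) = _ := fun k => congrFun (conj_nullVec (t, x)) k
  rw [fderiv_hopfMap_apply]
  have hv0 : (pushFactor t x • conj c • v₁ (hopfMap t x)) 0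
      = pushFactor t x * (conj c * -conj (beta t x)) := by
    simp [v₁_zero, hopfMap]
  have hv1 : (pushFactor t x • conj c • v₁ (hopfMap t x)) 1
      = pushFactor t x * (conj c * conj (alpha t x)) := by
    simp [v₁_one, hopfMap]
  ext j
  fin_cases j
  · refine Eq.trans ?_ hv0.symm
    simp only [Fin.zero_eta, Matrix.cons_val_zero, dAlpha, dInvDen, hre, hc, hβ, pushFactor_eq]
    simp only [conj_numA, conj_numB, nullVec, Matrix.cons_val, Complex.ofReal_zero]
    simp only [numA, numB]
    generalize conjInvDen (t, x) = e' at *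
    generalize invDen (t, x) = e at *
    generalize conj c = c' at *
    generalize ((x 0 : ℝ) : ℂ) = x0 at *
    generalize ((x 1 : ℝ) : ℂ) = x1 at *
    generalize ((x 2 : ℝ) : ℂ) = x2 at *
    generalize (t : ℂ) = t at *
    generalize Complex.I = I at *
    clear hα hβ hre hc hv0 hv1
    grind
  · refine Eq.trans ?_ hv1.symm
    simp only [Fin.mk_one, Matrix.cons_val_one, dBeta, dInvDen, hre, hc, hα, pushFactor_eq]
    simp only [conj_numA, conj_numB, nullVec, Matrix.cons_val, Complex.ofReal_zero]
    simp only [numA, numB]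
    generalize conjInvDen (t, x) = e' at *
    generalize invDen (t, x) = e at *
    generalize conj c = c' at *
    generalize ((x 0 : ℝ) : ℂ) = x0 at *
    generalize ((x 1 : ℝ) : ℂ) = x1 at *
    generalize ((x 2 : ℝ) : ℂ) = x2 at *
    generalize (t : ℂ) = t at *
    generalize Complex.I = I at *
    clear hα hβ hre hc hv0 hv1
    grind

/-! ### The equivalences -/

theorem pushesForwardTo_electric {h : C2 → ℂ} {X : S3 → C2} (hX : IsRePart (fun p => h p) X) :
    PushesForwardTo (electric (batemanField h)) X := by
  intro t x
  rw [isRePart_iff.1 hX]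
  simp only [electric, batemanField_apply]
  exact fderiv_hopfMap_re t x _

theorem pushesForwardTo_magnetic {h : C2 → ℂ} {X : S3 → C2} (hX : IsImPart (fun p => h p) X) :
    PushesForwardTo (magnetic (batemanField h)) X := by
  intro t x
  rw [isImPart_iff.1 hX]
  -- `Im F = Re (-i F)`
  have h1 : magnetic (batemanField h) t x = WithLp.toLp 2 fun k =>
      ((-Complex.I * h (hopfMap t x)) * (4 * invDen (t, x) ^ 3 * nullVec (t, x) k)).re := by
    ext k
    simp only [magnetic, batemanField_apply]
    rw [mul_assoc (-Complex.I), neg_mul, Complex.neg_re, Complex.I_mul_re, neg_neg]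
  rw [h1, fderiv_hopfMap_re]
  simp [hopfMapS3]

theorem isOfBatemanType_iff {f : S3 → ℂ} (hf : IsRealAnalytic f) {X : S3 → C2}
    (hX : IsRePart f X) : IsOfBatemanType X (J X) ↔ ExtendsHolomorphically f := by
  constructor
  · rintro ⟨h, hh, -, -, hre, -⟩
    exact ⟨h, hh, fun p => congrFun (hre.unique hX) p⟩
  · rintro ⟨h, ⟨U, hU, hSU, hd⟩, hhf⟩
    obtain rfl : (fun p : S3 => h p) = f := funext hhf
    exact ⟨h, ⟨U, hU, hSU, hd⟩,
      isMaxwell_batemanField (fun p => hd.differentiableAt (hU.mem_nhds (hSU p.2))) hf,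
      isNull_batemanField h, hX, hX.isImPart_J, pushesForwardTo_electric hX,
      pushesForwardTo_magnetic hX.isImPart_J⟩

theorem isCR_iff_extendsHolomorphically {f : S3 → ℂ} (hf : IsRealAnalytic f) :
    IsCR f ↔ ExtendsHolomorphically f :=
  ⟨fun h => h.extendsHolomorphically hf, fun h => h.isCR⟩

end HopfBateman

end

theorem theorem1p1 (E₀ : S3 → C2) (hE₀ : IsRealAnalytic E₀) (hLeg : IsLegendrian E₀) :
    (IsOfBatemanType E₀ (J E₀) ↔ (∀ p, divS3 E₀ p = 0) ∧ (∀ p, divS3 (J E₀) p = 0)) ∧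
    (∃! Θ : S3 → ℂ, IsRePart Θ E₀) ∧
    (∀ Θ : S3 → ℂ, IsRePart Θ E₀ →
      IsImPart Θ (J E₀) ∧ IsRealAnalytic Θ ∧
      (IsOfBatemanType E₀ (J E₀) ↔ IsCR Θ) ∧
      (IsOfBatemanType E₀ (J E₀) ↔ ExtendsHolomorphically Θ)) := by
  obtain ⟨f, hf⟩ := hLeg.exists_isRePart
  have key : ∀ Θ : S3 → ℂ, IsRePart Θ E₀ →
      (IsOfBatemanType E₀ (J E₀) ↔ ExtendsHolomorphically Θ) ∧
      (IsOfBatemanType E₀ (J E₀) ↔ IsCR Θ) := fun Θ hΘ => by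
    have hΘa := hΘ.isRealAnalytic hE₀
    have h := isOfBatemanType_iff hΘa hΘ
    exact ⟨h, h.trans (isCR_iff_extendsHolomorphically hΘa).symm⟩
  refine ⟨(key f hf).2.trans (isCR_iff_divS3 (hf.isRealAnalytic hE₀) hf),
    ⟨f, hf, fun g hg => hg.unique hf⟩, fun Θ hΘ => ⟨hΘ.isImPart_J, hΘ.isRealAnalytic hE₀, ?_⟩⟩
  exact ⟨(key Θ hΘ).2, (key Θ hΘ).1⟩
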